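/- An ultragraph $\mathcal{G}=(G^0,\mathcal{G}^1,r,s)$ consists of sets $G^0$ (vertices) and $\mathcal{G}^1$ (edges), a map $s:\mathcal{G}^1\to G^0$ and a map $r:\mathcal{G}^1\to P(G^0)\setminus\{\emptyset\}$. Let $\mathcal{G}^0$ be the smallest family of subsets of $G^0$ that contains $\emptyset$, all $\{v\}$ ($v\in G^0$) and all $r(e)$ ($e\in\mathcal{G}^1$), and is closed under finite unions and (nonempty) finite intersections. Let $R$ be a commutative ring with $1\neq 0$. The Leavitt path algebra $L_R(\mathcal{G})$ is the universal (not necessarily unital) associative $R$-algebra with generators $p_A$ ($A\in\mathcal{G}^0$) and $s_e,s_e^*$ ($e\in\mathcal{G}^1$) and relations (1) $p_\emptyset=0$, $p_Ap_B=p_{A\cap B}$, $p_{A\cup B}=p_A+p_B-p_{A\cap B}$; (2) $p_{s(e)}s_e=s_ep_{r(e)}=s_e$ and $p_{r(e)}s_e^*=s_e^*p_{s(e)}=s_e^*$; (3) $s_e^*s_f=\delta_{e,f}\,p_{r(e)}$; (4) $p_v=\sum_{s(e)=v}s_es_e^*$ whenever $0<|s^{-1}(v)|<\infty$, where $p_v=p_{\{v\}}$.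 A $\mathcal{G}$-branching system on a set $X$ consists of subsets $R_e,D_A\subseteq X$ and bijections $f_e:D_{r(e)}\to R_e$ ($e\in\mathcal{G}^1$, $A\in\mathcal{G}^0$) such that $R_e\cap R_f=\emptyset$ for $e\neq f$; $D_\emptyset=\emptyset$, $D_A\cap D_B=D_{A\cap B}$ and $D_A\cup D_B=D_{A\cup B}$; $R_e\subseteq D_{s(e)}$; and $D_v=\bigcup_{s(e)=v}R_e$ whenever $0<|s^{-1}(v)|<\infty$ (where $D_v=D_{\{v\}}$). Let $M$ be the $R$-module of all functions $X\to R$. The induced representation is the unique $R$-algebra homomorphism $\pi:L_R(\mathcal{G})\to\operatorname{Hom}_R(M,M)$ with $\pi(s_e)\phi=(\phi\circ f_e^{-1})\cdot 1_{R_e}$, $\pi(s_e^*)\phi=(\phi\circ f_e)\cdot 1_{D_{r(e)}}$ and $\pi(p_A)\phi=\phi\cdot 1_{D_A}$ for all $\phi\in M$. It is called faithful if it is injective. A cycle is a sequence of edges $c=c_1\cdots c_k$, $k\geq 1$, with $s(c_{i+1})\in r(c_i)$ for $1\le i<k$, $s(c_1)\in r(c_k)$, and $s(c_i)\neq s(c_j)$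 for $i\neq j$. Put $r(c)=r(c_k)$ and $c_{k+1}=c_1$. The cycle $c$ has an exit if for some $i$ there is an edge $e\neq c_{i+1}$ with $s(e)\in r(c_i)$, or a vertex $w\in r(c_i)$ with $s^{-1}(w)=\emptyset$. For a cycle $c$ let $f_c=f_{c_1}\circ\cdots\circ f_{c_k}$, which maps $D_{r(c)}$ into itself. Theorem. Let $\mathcal{G}$ be an ultragraph, $R$ a commutative ring with $1\neq0$, and $\{R_e,D_A,f_e\}$ a $\mathcal{G}$-branching system on a set $X$ such that $D_A\neq\emptyset$ for every nonempty $A\in\mathcal{G}^0$. Then the induced representation of $L_R(\mathcal{G})$ is faithful if and only if for every cycle $c$ without exit and every finite set $F$ of positive integers there exists $z_0\in D_{r(c)}$ such that $f_c^n(z_0)\neq z_0$ for all $n\in F$. -/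

import Mathlib

universe u v w x y

/-- An ultragraph with vertex set `V` and edge set `E`. -/
structure Ultragraph (V : Type u) (E : Type v) where
  source : E → V
  range : E → Set V
  range_nonempty : ∀ e, (range e).Nonempty

namespace Ultragraph

variable {V : Type u} {E : Type v}

/-- Membership in the smallest family of sets of vertices which contains the empty set, all
singletons and all ranges of edges, and is closed under finite unions and finite intersections. -/
inductive IsGenVertex (G : Ultragraph V E) : Set V → Prop
  | empty : IsGenVertex G ∅
  | singleton (v : V) : IsGenVertex G {v}
  | range (e : E) : IsGenVertex G (G.range e)
  | union {A B : Set V} : IsGenVertex G A → IsGenVertex G B → IsGenVertex G (A ∪ B)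
  | inter {A B : Set V} : IsGenVertex G A → IsGenVertex G B → IsGenVertex G (A ∩ B)

/-- The generalized vertices of an ultragraph. -/
def GenVertex (G : Ultragraph V E) : Type u := {A : Set V // G.IsGenVertex A}

namespace GenVertex

variable {G : Ultragraph V E}

instance : EmptyCollection G.GenVertex := ⟨⟨∅, IsGenVertex.empty⟩⟩

instance : Union G.GenVertex := ⟨fun A B => ⟨A.1 ∪ B.1, IsGenVertex.union A.2 B.2⟩⟩

instance : Inter G.GenVertex := ⟨fun A B => ⟨A.1 ∩ B.1, IsGenVertex.inter A.2 B.2⟩⟩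

end GenVertex

/-- The generalized vertex `{v}`. -/
def vtx (G : Ultragraph V E) (v : V) : G.GenVertex := ⟨{v}, IsGenVertex.singleton v⟩

/-- The generalized vertex `r(e)`. -/
def rng (G : Ultragraph V E) (e : E) : G.GenVertex := ⟨G.range e, IsGenVertex.range e⟩

/-- A sink is a vertex that emits no edge. -/
def IsSink (G : Ultragraph V E) (v : V) : Prop := ∀ e, G.source e ≠ v

/-- The sequence of edges `c 0, …, c k` is a path. -/
def IsPath (G : Ultragraph V E) {k : ℕ} (c : Fin (k + 1) → E) : Prop :=
  ∀ i : Fin k, G.source (c i.succ) ∈ G.range (c i.castSucc)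

/-- A closed path is a path of positive length whose source lies in its range. -/
def IsClosedPath (G : Ultragraph V E) {k : ℕ} (c : Fin (k + 1) → E) : Prop :=
  G.IsPath c ∧ G.source (c 0) ∈ G.range (c (Fin.last k))

/-- A cycle is a closed path whose edges have pairwise distinct sources. -/
def IsCycle (G : Ultragraph V E) {k : ℕ} (c : Fin (k + 1) → E) : Prop :=
  G.IsClosedPath c ∧ ∀ i j, i ≠ j → G.source (c i) ≠ G.source (c j)

/-- An exit of a closed path is an edge that starts in the range of some edge of the path but is
not the next edge, or a sink in the range of some edge of the path. The addition `i + 1` in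
`Fin (k + 1)` is cyclic: the edge after the last one is the first one. -/
def HasExit (G : Ultragraph V E) {k : ℕ} (c : Fin (k + 1) → E) : Prop :=
  (∃ (i : Fin (k + 1)) (e : E), G.source e ∈ G.range (c i) ∧ e ≠ c (i + 1)) ∨
    ∃ (i : Fin (k + 1)) (w : V), G.IsSink w ∧ w ∈ G.range (c i)

/-! ### The Leavitt path algebra -/

/-- The defining relations of the Leavitt path algebra, for elements `p A`, `s e`, `t e`
(where `t e` stands for the ghost edge of `e`) of a not necessarily unital ring. -/
structure IsLeavittFamily (G : Ultragraph V E) {B : Type w} [NonUnitalRing B]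
    (p : G.GenVertex → B) (s t : E → B) : Prop where
  p_empty : p ∅ = 0
  p_mul : ∀ A C, p A * p C = p (A ∩ C)
  p_union : ∀ A C, p (A ∪ C) = p A + p C - p (A ∩ C)
  source_mul : ∀ e, p (G.vtx (G.source e)) * s e = s e
  mul_range : ∀ e, s e * p (G.rng e) = s e
  range_mul_ghost : ∀ e, p (G.rng e) * t e = t e
  ghost_mul_source : ∀ e, t e * p (G.vtx (G.source e)) = t e
  ghost_mul_self : ∀ e, t e * s e = p (G.rng e)
  ghost_mul_of_ne : ∀ e f, e ≠ f → t e * s f = 0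
  vertex : ∀ (v : V) (h : {e | G.source e = v}.Finite), {e | G.source e = v}.Nonempty →
    p (G.vtx v) = ∑ e ∈ h.toFinset, s e * t e

/-- The generators of the Leavitt path algebra. -/
inductive LeavittGen (G : Ultragraph V E) : Type (max u v)
  | vert (A : G.GenVertex)
  | edge (e : E)
  | ghost (e : E)

section Algebra

variable (G : Ultragraph V E) (R : Type w) [CommRing R]

/-- The free (non-unital) associative `R`-algebra on the generators. -/
abbrev FreeGen : Type (max u v w) := MonoidAlgebra R (FreeSemigroup G.LeavittGen)

noncomputable section

/-- A generator as an element of the free algebra. -/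
def genOf (g : G.LeavittGen) : G.FreeGen R := MonoidAlgebra.single (FreeSemigroup.of g) 1

/-- The relation `a ∼ b` for each of the defining relations `a = b`. -/
inductive LeavittRel : G.FreeGen R → G.FreeGen R → Prop
  | p_empty : LeavittRel (G.genOf R (.vert ∅)) 0
  | p_mul (A C : G.GenVertex) :
      LeavittRel (G.genOf R (.vert A) * G.genOf R (.vert C)) (G.genOf R (.vert (A ∩ C)))
  | p_union (A C : G.GenVertex) :
      LeavittRel (G.genOf R (.vert (A ∪ C)))
        (G.genOf R (.vert A) + G.genOf R (.vert C) - G.genOf R (.vert (A ∩ C)))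
  | source_mul (e : E) :
      LeavittRel (G.genOf R (.vert (G.vtx (G.source e))) * G.genOf R (.edge e))
        (G.genOf R (.edge e))
  | mul_range (e : E) :
      LeavittRel (G.genOf R (.edge e) * G.genOf R (.vert (G.rng e))) (G.genOf R (.edge e))
  | range_mul_ghost (e : E) :
      LeavittRel (G.genOf R (.vert (G.rng e)) * G.genOf R (.ghost e)) (G.genOf R (.ghost e))
  | ghost_mul_source (e : E) :
      LeavittRel (G.genOf R (.ghost e) * G.genOf R (.vert (G.vtx (G.source e))))
        (G.genOf R (.ghost e))
  | ghost_mul_self (e : E) :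
      LeavittRel (G.genOf R (.ghost e) * G.genOf R (.edge e)) (G.genOf R (.vert (G.rng e)))
  | ghost_mul_of_ne (e f : E) (h : e ≠ f) :
      LeavittRel (G.genOf R (.ghost e) * G.genOf R (.edge f)) 0
  | vertex (v : V) (h : {e | G.source e = v}.Finite) (hne : {e | G.source e = v}.Nonempty) :
      LeavittRel (G.genOf R (.vert (G.vtx v)))
        (∑ e ∈ h.toFinset, G.genOf R (.edge e) * G.genOf R (.ghost e))

/-- The congruence of `R`-algebras generated by the defining relations. -/
def leavittCon : RingCon (G.FreeGen R) :=
  ringConGen fun a b => ∃ (l : R) (x y : G.FreeGen R),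
    G.LeavittRel R x y ∧ a = l • x ∧ b = l • y

/-- The Leavitt path algebra `L_R(G)`: the universal (not necessarily unital) `R`-algebra generated
by a family subject to the defining relations. -/
def LeavittPathAlgebra : Type (max u v w) := (G.leavittCon R).Quotient

namespace LeavittPathAlgebra

instance : NonUnitalRing (G.LeavittPathAlgebra R) :=
  inferInstanceAs (NonUnitalRing (G.leavittCon R).Quotient)

variable {G R} in
theorem con_smul (l : R) {a b : G.FreeGen R} (h : G.leavittCon R a b) :
    G.leavittCon R (l • a) (l • b) := by
  change RingConGen.Rel _ a b at h
  change RingConGen.Rel _ _ _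
  induction h with
  | of a b h =>
    obtain ⟨m, x, y, hxy, rfl, rfl⟩ := h
    exact RingConGen.Rel.of _ _ ⟨l * m, x, y, hxy, smul_smul _ _ _, smul_smul _ _ _⟩
  | refl a => exact RingConGen.Rel.refl _
  | symm _ ih => exact ih.symm
  | trans _ _ ih₁ ih₂ => exact ih₁.trans ih₂
  | add _ _ ih₁ ih₂ => rw [smul_add, smul_add]; exact ih₁.add ih₂
  | mul _ hb ih₁ _ => rw [← smul_mul_assoc, ← smul_mul_assoc]; exact ih₁.mul hb

/-- The quotient map from the free algebra. -/
def mk (a : G.FreeGen R) : G.LeavittPathAlgebra R := (a : (G.leavittCon R).Quotient)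

theorem mk_surjective : Function.Surjective (mk G R) := Quotient.mk_surjective

instance : SMul R (G.LeavittPathAlgebra R) :=
  ⟨fun l => Quotient.map (l • ·) fun _ _ h => con_smul l h⟩

/-- The quotient map as a homomorphism of additive groups. -/
def mkAddHom : G.FreeGen R →+ G.LeavittPathAlgebra R where
  toFun := mk G R
  map_zero' := rfl
  map_add' _ _ := rfl

instance : Module R (G.LeavittPathAlgebra R) :=
  Function.Surjective.module R (mkAddHom G R) (mk_surjective G R) fun _ _ => rfl

instance : IsScalarTower R (G.LeavittPathAlgebra R) (G.LeavittPathAlgebra R) where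
  smul_assoc l a b := by
    obtain ⟨a, rfl⟩ := mk_surjective G R a
    obtain ⟨b, rfl⟩ := mk_surjective G R b
    exact congrArg (mk G R) (smul_mul_assoc l a b)

instance : SMulCommClass R (G.LeavittPathAlgebra R) (G.LeavittPathAlgebra R) where
  smul_comm l a b := by
    obtain ⟨a, rfl⟩ := mk_surjective G R a
    obtain ⟨b, rfl⟩ := mk_surjective G R b
    exact congrArg (mk G R) (mul_smul_comm l a b).symm

/-- The quotient map as a homomorphism of `R`-algebras. -/
def mkHom : G.FreeGen R →ₙₐ[R] G.LeavittPathAlgebra R where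
  toFun := mk G R
  map_smul' _ _ := rfl
  map_zero' := rfl
  map_add' _ _ := rfl
  map_mul' _ _ := rfl

/-- The generator `p_A`. -/
def p (A : G.GenVertex) : G.LeavittPathAlgebra R := mkHom G R (G.genOf R (.vert A))

/-- The generator `s_e`. -/
def s (e : E) : G.LeavittPathAlgebra R := mkHom G R (G.genOf R (.edge e))

/-- The generator `s_e^*`. -/
def sStar (e : E) : G.LeavittPathAlgebra R := mkHom G R (G.genOf R (.ghost e))

variable {G R} in
theorem mkHom_eq_of_rel {a b : G.FreeGen R} (h : G.LeavittRel R a b) :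
    mkHom G R a = mkHom G R b :=
  Quotient.sound (RingConGen.Rel.of _ _ ⟨1, a, b, h, (one_smul _ _).symm, (one_smul _ _).symm⟩)

/-- The generators of the Leavitt path algebra satisfy the defining relations. -/
theorem isLeavittFamily : G.IsLeavittFamily (p G R) (s G R) (sStar G R) where
  p_empty := (mkHom_eq_of_rel .p_empty).trans (map_zero _)
  p_mul A C := (map_mul _ _ _).symm.trans (mkHom_eq_of_rel (.p_mul A C))
  p_union A C := (mkHom_eq_of_rel (.p_union A C)).trans (by simp [p])
  source_mul e := (map_mul _ _ _).symm.trans (mkHom_eq_of_rel (.source_mul e))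
  mul_range e := (map_mul _ _ _).symm.trans (mkHom_eq_of_rel (.mul_range e))
  range_mul_ghost e := (map_mul _ _ _).symm.trans (mkHom_eq_of_rel (.range_mul_ghost e))
  ghost_mul_source e := (map_mul _ _ _).symm.trans (mkHom_eq_of_rel (.ghost_mul_source e))
  ghost_mul_self e := (map_mul _ _ _).symm.trans (mkHom_eq_of_rel (.ghost_mul_self e))
  ghost_mul_of_ne e f h := (map_mul _ _ _).symm.trans
    ((mkHom_eq_of_rel (.ghost_mul_of_ne e f h)).trans (map_zero _))
  vertex v h hne := (mkHom_eq_of_rel (.vertex v h hne)).trans (by simp [s, sStar, map_sum])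

variable {B : Type x} [NonUnitalRing B] [Module R B] [IsScalarTower R B B] [SMulCommClass R B B]
variable {G}

/-- The values on the generators of the homomorphism given by a family. -/
def genVal (p' : G.GenVertex → B) (s' t' : E → B) : G.LeavittGen → B
  | .vert A => p' A
  | .edge e => s' e
  | .ghost e => t' e

/-- The homomorphism on the free algebra given by a family. -/
def freeLift (p' : G.GenVertex → B) (s' t' : E → B) : G.FreeGen R →ₙₐ[R] B :=
  MonoidAlgebra.liftMagma R (FreeSemigroup.lift (genVal p' s' t'))

theorem freeLift_genOf (p' : G.GenVertex → B) (s' t' : E → B) (g : G.LeavittGen) :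
    freeLift R p' s' t' (G.genOf R g) = genVal p' s' t' g := by
  simp [freeLift, genOf, MonoidAlgebra.liftMagma]

variable {p' : G.GenVertex → B} {s' t' : E → B}

theorem freeLift_eq (h : G.IsLeavittFamily p' s' t') {a b : G.FreeGen R}
    (hab : G.leavittCon R a b) : freeLift R p' s' t' a = freeLift R p' s' t' b := by
  change RingConGen.Rel _ a b at hab
  induction hab with
  | of a b hab =>
    obtain ⟨l, x, y, hxy, rfl, rfl⟩ := hab
    rw [map_smul, map_smul]
    congr 1
    cases hxy with
    | p_empty => simpa [freeLift_genOf, genVal] using h.p_empty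
    | p_mul A C => simpa [freeLift_genOf, genVal] using h.p_mul A C
    | p_union A C => simpa [freeLift_genOf, genVal] using h.p_union A C
    | source_mul e => simpa [freeLift_genOf, genVal] using h.source_mul e
    | mul_range e => simpa [freeLift_genOf, genVal] using h.mul_range e
    | range_mul_ghost e => simpa [freeLift_genOf, genVal] using h.range_mul_ghost e
    | ghost_mul_source e => simpa [freeLift_genOf, genVal] using h.ghost_mul_source e
    | ghost_mul_self e => simpa [freeLift_genOf, genVal] using h.ghost_mul_self e
    | ghost_mul_of_ne e f hef => simpa [freeLift_genOf, genVal] using h.ghost_mul_of_ne e f hef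
    | vertex v hf hne => simpa [freeLift_genOf, genVal, map_sum] using h.vertex v hf hne
  | refl a => rfl
  | symm _ ih => exact ih.symm
  | trans _ _ ih₁ ih₂ => exact ih₁.trans ih₂
  | add _ _ ih₁ ih₂ => rw [map_add, map_add, ih₁, ih₂]
  | mul _ _ ih₁ ih₂ => rw [map_mul, map_mul, ih₁, ih₂]

/-- The universal property: a family in `B` that satisfies the defining relations induces a
homomorphism from the Leavitt path algebra to `B`. -/
def lift (h : G.IsLeavittFamily p' s' t') : G.LeavittPathAlgebra R →ₙₐ[R] B where
  toFun := Quotient.lift (freeLift R p' s' t') fun _ _ hab => freeLift_eq R h hab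
  map_smul' l a := by
    obtain ⟨a, rfl⟩ := mk_surjective G R a
    exact map_smul (freeLift R p' s' t') l a
  map_zero' := map_zero (freeLift R p' s' t')
  map_add' a b := by
    obtain ⟨a, rfl⟩ := mk_surjective G R a
    obtain ⟨b, rfl⟩ := mk_surjective G R b
    exact map_add (freeLift R p' s' t') a b
  map_mul' a b := by
    obtain ⟨a, rfl⟩ := mk_surjective G R a
    obtain ⟨b, rfl⟩ := mk_surjective G R b
    exact map_mul (freeLift R p' s' t') a b

theorem lift_p (h : G.IsLeavittFamily p' s' t') (A : G.GenVertex) :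
    lift R h (p G R A) = p' A := freeLift_genOf R p' s' t' (.vert A)

theorem lift_s (h : G.IsLeavittFamily p' s' t') (e : E) :
    lift R h (s G R e) = s' e := freeLift_genOf R p' s' t' (.edge e)

theorem lift_sStar (h : G.IsLeavittFamily p' s' t') (e : E) :
    lift R h (sStar G R e) = t' e := freeLift_genOf R p' s' t' (.ghost e)

/-- A homomorphism from the Leavitt path algebra is determined by its values on the generators. -/
theorem hom_ext {φ ψ : G.LeavittPathAlgebra R →ₙₐ[R] B} (hp : ∀ A, φ (p G R A) = ψ (p G R A))
    (hs : ∀ e, φ (s G R e) = ψ (s G R e)) (ht : ∀ e, φ (sStar G R e) = ψ (sStar G R e)) :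
    φ = ψ := by
  have key : φ.comp (mkHom G R) = ψ.comp (mkHom G R) := by
    apply (MonoidAlgebra.liftMagma R).symm.injective
    apply FreeSemigroup.hom_ext
    funext g
    cases g with
    | vert A => exact hp A
    | edge e => exact hs e
    | ghost e => exact ht e
  ext a
  obtain ⟨a, rfl⟩ := mk_surjective G R a
  exact DFunLike.congr_fun key a

end LeavittPathAlgebra

end

end Algebra

/-! ### Branching systems and their induced representations -/

/-- An algebraic branching system of the ultragraph `G` on the set `X`. -/
structure BranchingSystem (G : Ultragraph V E) (X : Type y) where
  R : E → Set X
  D : G.GenVertex → Set X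
  f : ∀ e, D (G.rng e) ≃ R e
  R_disjoint : ∀ e e', e ≠ e' → R e ∩ R e' = ∅
  D_empty : D ∅ = ∅
  D_inter : ∀ A C, D A ∩ D C = D (A ∩ C)
  D_union : ∀ A C, D A ∪ D C = D (A ∪ C)
  R_subset : ∀ e, R e ⊆ D (G.vtx (G.source e))
  D_vertex : ∀ v, {e | G.source e = v}.Finite → {e | G.source e = v}.Nonempty →
    D (G.vtx v) = ⋃ e ∈ {e | G.source e = v}, R e

namespace BranchingSystem

noncomputable section

open scoped Classical

variable {G : Ultragraph V E} {X : Type y}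

section Representation

variable (R : Type w) [CommRing R] (B : G.BranchingSystem X)

/-- `S_e φ = (φ ∘ f_e⁻¹) · 1_{R_e}`. -/
def S (e : E) : Module.End R (X → R) where
  toFun φ z := if h : z ∈ B.R e then φ ((B.f e).symm ⟨z, h⟩) else 0
  map_add' φ ψ := by funext z; by_cases h : z ∈ B.R e <;> simp [h]
  map_smul' l φ := by funext z; by_cases h : z ∈ B.R e <;> simp [h]

/-- `S_e^* φ = (φ ∘ f_e) · 1_{D_{r(e)}}`. -/
def SStar (e : E) : Module.End R (X → R) where
  toFun φ z := if h : z ∈ B.D (G.rng e) then φ (B.f e ⟨z, h⟩) else 0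
  map_add' φ ψ := by funext z; by_cases h : z ∈ B.D (G.rng e) <;> simp [h]
  map_smul' l φ := by funext z; by_cases h : z ∈ B.D (G.rng e) <;> simp [h]

/-- `P_A φ = φ · 1_{D_A}`. -/
def P (A : G.GenVertex) : Module.End R (X → R) where
  toFun φ z := if z ∈ B.D A then φ z else 0
  map_add' φ ψ := by funext z; by_cases h : z ∈ B.D A <;> simp [h]
  map_smul' l φ := by funext z; by_cases h : z ∈ B.D A <;> simp [h]

theorem S_mul_SStar (e : E) (φ : X → R) (z : X) :
    (B.S R e * B.SStar R e) φ z = if z ∈ B.R e then φ z else 0 := by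
  by_cases h : z ∈ B.R e <;> simp [S, SStar, h]

/-- The operators of a branching system satisfy the relations of the Leavitt path algebra. -/
theorem isLeavittFamily : G.IsLeavittFamily (B.P R) (B.S R) (B.SStar R) where
  p_empty := by
    ext φ z
    simp [P, B.D_empty]
  p_mul A C := by
    ext φ z
    simp only [P, ← B.D_inter]
    by_cases hA : z ∈ B.D A <;> by_cases hC : z ∈ B.D C <;> simp [hA, hC]
  p_union A C := by
    ext φ z
    simp only [P, ← B.D_inter, ← B.D_union]
    by_cases hA : z ∈ B.D A <;> by_cases hC : z ∈ B.D C <;> simp [hA, hC]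
  source_mul e := by
    ext φ z
    by_cases h : z ∈ B.R e
    · simp [P, S, h, B.R_subset e h]
    · simp [P, S, h]
  mul_range e := by
    ext φ z
    by_cases h : z ∈ B.R e <;> simp [P, S, h]
  range_mul_ghost e := by
    ext φ z
    by_cases h : z ∈ B.D (G.rng e) <;> simp [P, SStar, h]
  ghost_mul_source e := by
    ext φ z
    by_cases h : z ∈ B.D (G.rng e)
    · simp [P, SStar, h, B.R_subset e (B.f e ⟨z, h⟩).2]
    · simp [SStar, h]
  ghost_mul_self e := by
    ext φ z
    by_cases h : z ∈ B.D (G.rng e) <;> simp [P, S, SStar, h]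
  ghost_mul_of_ne e e' hne := by
    ext φ z
    by_cases h : z ∈ B.D (G.rng e)
    · have h' : (B.f e ⟨z, h⟩ : X) ∉ B.R e' := fun h' =>
        (Set.ext_iff.1 (B.R_disjoint e e' hne) _).1 ⟨(B.f e ⟨z, h⟩).2, h'⟩
      simp [S, SStar, h, h']
    · simp [SStar, h]
  vertex v hf hne := by
    apply LinearMap.ext; intro φ; funext z
    rw [LinearMap.sum_apply, Finset.sum_apply]
    simp only [S_mul_SStar]
    by_cases hz : z ∈ B.D (G.vtx v)
    · have hz' := hz
      rw [B.D_vertex v hf hne] at hz'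
      simp only [Set.mem_iUnion] at hz'
      obtain ⟨e, he, hze⟩ := hz'
      rw [Finset.sum_eq_single e]
      · simp [P, hz, hze]
      · intro e' _ hne'
        rw [if_neg]
        exact fun h' => (Set.ext_iff.1 (B.R_disjoint e' e hne') _).1 ⟨h', hze⟩
      · intro h; exact absurd (hf.mem_toFinset.2 he) h
    · rw [Finset.sum_eq_zero]
      · simp [P, hz]
      · intro e he
        have he' : G.source e = v := hf.mem_toFinset.1 he
        rw [if_neg]
        intro h; exact hz (he' ▸ B.R_subset e h)

/-- The representation of `L_R(G)` on the module of all functions `X → R` that is induced by a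
branching system. -/
def inducedRep : G.LeavittPathAlgebra R →ₙₐ[R] Module.End R (X → R) :=
  LeavittPathAlgebra.lift R (B.isLeavittFamily R)

end Representation

variable (B : G.BranchingSystem X)

/-- The map `f_e : D_{r(e)} → R_e`, extended by the identity to a map `X → X`. -/
def edgeMap (e : E) (z : X) : X := if h : z ∈ B.D (G.rng e) then B.f e ⟨z, h⟩ else z

/-- The composition `f_c = f_{c_0} ∘ ⋯ ∘ f_{c_k}`. If `c` is a path, then the values at points of
`D_{r(c)}` do not depend on how the edge maps are extended; see `pathMap_mem` below. -/
def pathMap {k : ℕ} (c : Fin (k + 1) → E) : X → X :=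
  (List.ofFn c).foldr (fun e g => B.edgeMap e ∘ g) id

theorem edgeMap_mem (e : E) {z : X} (hz : z ∈ B.D (G.rng e)) : B.edgeMap e z ∈ B.R e := by
  simp [edgeMap, hz]

theorem R_subset_of_mem {e e' : E} (h : G.source e ∈ G.range e') :
    B.R e ⊆ B.D (G.rng e') := by
  refine (B.R_subset e).trans ?_
  have : G.vtx (G.source e) ∩ G.rng e' = G.vtx (G.source e) :=
    Subtype.ext (Set.inter_eq_left.2 (Set.singleton_subset_iff.2 h))
  rw [← this, ← B.D_inter]
  exact Set.inter_subset_right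

/-- For a path `c`, the map `f_c` sends `D_{r(c)}` to `R_{c_0}`. -/
theorem pathMap_mem : ∀ {k : ℕ} (c : Fin (k + 1) → E), G.IsPath c → ∀ {z : X},
    z ∈ B.D (G.rng (c (Fin.last k))) → B.pathMap c z ∈ B.R (c 0)
  | 0, c, _, z, hz => by
    simpa [pathMap] using B.edgeMap_mem (c 0) hz
  | k + 1, c, hc, z, hz => by
    have ih := pathMap_mem (fun i : Fin (k + 1) => c i.succ) (fun i => hc i.succ) (z := z) hz
    have h0 := B.edgeMap_mem (c 0) (B.R_subset_of_mem (hc 0) ih)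
    simpa [pathMap, List.ofFn_succ (f := c)] using h0

/-- For a closed path `c`, the map `f_c` sends `D_{r(c)}` to itself, so it can be iterated. -/
theorem pathMap_mapsTo {k : ℕ} (c : Fin (k + 1) → E) (hc : G.IsClosedPath c) :
    Set.MapsTo (B.pathMap c) (B.D (G.rng (c (Fin.last k)))) (B.D (G.rng (c (Fin.last k)))) :=
  fun _ hz => B.R_subset_of_mem hc.2 (B.pathMap_mem c hc.1 hz)

end

end BranchingSystem

end Ultragraph

/-! Sufficiency rests on a uniqueness theorem for an algebra homomorphism `Φ` on a Leavitt family: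
`Φ` is injective on the span of the words `s_α p_A s_β^*` as soon as it kills no `r p_v` with `r ≠
0` and, for a cycle `c` without exit, no polynomial in `c` with nonzero constant term
(`IsReductionFaithful.eq_zero_of_mem_wordSpan`). All of this takes place in the unitization of
`L_R(G)`, so that the empty path can be the word `1`.

Constant terms: if `Φ` kills `r p_v + y`, with `y` a combination of nonempty closed paths at `v`,
then `r = 0`. Conjugating by a path that winds around a cycle at `v` and leaves through an exit
removes `y`; if the cycle has no exit, all closed paths at `v` are powers of it and the hypothesis
on cycles applies. Cancelling a shortest path on the left then shows that distinct paths are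
independent modulo the kernel, which settles combinations of the words `s_α p_A`. Induction on the
length of ghost paths does the rest: for `x` in the kernel each `x s_f` has shorter ghost parts, so
it vanishes, and this forces `x` itself into the span of the words without ghost edges.

For the induced representation, both hypotheses are checked on test functions: the constant `1` at a
point of `D_v`, and the indicator of a point of `D_{r(c)}` that no `f_c^n` fixes, for the finitely
many exponents `n` that occur.

Necessity: if every point of `D_{r(c)}` is fixed by some `f_c^n` with `n ∈ F`, then `f_c^N` is the
identity there for `N = ∏ F`, so the representation kills `c^N p_{r(c)} - p_{r(c)}`. That element is
nonzero, because it acts nontrivially for the branching system on `X × ℤ` whose second coordinate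
counts edges. -/

namespace Ultragraph

/-! ### Paths as lists of edges -/

section Paths

variable {V : Type*} {E : Type*} (G : Ultragraph V E)

/-- The source of a list of edges; the empty list is considered as a path of length zero at `v`. -/
def pathSource : List E → V → V
  | [], v => v
  | e :: _, _ => G.source e

/-- The list of edges is a path whose range contains `v`. -/
def IsPathTo : List E → V → Prop
  | [], _ => True
  | e :: l, v => G.pathSource l v ∈ G.range e ∧ IsPathTo l v

variable {G}

theorem pathSource_append (l l' : List E) (v : V) :
    G.pathSource (l ++ l') v = G.pathSource l (G.pathSource l' v) := by
  cases l <;> rfl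

theorem isPathTo_append (l l' : List E) (v : V) :
    G.IsPathTo (l ++ l') v ↔ G.IsPathTo l (G.pathSource l' v) ∧ G.IsPathTo l' v := by
  induction l with
  | nil => simp [IsPathTo]
  | cons e l ih => simp [IsPathTo, ih, pathSource_append, and_assoc]

end Paths

/-! ### Words in a Leavitt family -/

section Words

variable {E : Type*} {U : Type*} [Ring U]

/-- The product of the edges in a list. -/
def edgeWord (s : E → U) (l : List E) : U := (l.map s).prod

/-- The product of the ghost edges in a list, in reverse order. -/
def ghostWord (t : E → U) (l : List E) : U := (l.reverse.map t).prod

variable (s t : E → U)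

@[simp] theorem edgeWord_nil : edgeWord s [] = 1 := rfl

@[simp] theorem edgeWord_cons (e : E) (l : List E) :
    edgeWord s (e :: l) = s e * edgeWord s l := by simp [edgeWord]

theorem edgeWord_append (l l' : List E) :
    edgeWord s (l ++ l') = edgeWord s l * edgeWord s l' := by simp [edgeWord]

@[simp] theorem ghostWord_nil : ghostWord t [] = 1 := rfl

@[simp] theorem ghostWord_cons (e : E) (l : List E) :
    ghostWord t (e :: l) = ghostWord t l * t e := by simp [ghostWord]

theorem ghostWord_append (l l' : List E) :
    ghostWord t (l ++ l') = ghostWord t l' * ghostWord t l := by simp [ghostWord]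

end Words

/-! ### Products of paths, ghost paths and projections -/

namespace IsLeavittFamily

section

variable {V : Type*} {E : Type*} {G : Ultragraph V E} {U : Type*} [Ring U]
variable {p : G.GenVertex → U} {s t : E → U} (h : G.IsLeavittFamily p s t)

include h

theorem p_mul_of_subset {A C : G.GenVertex} (hAC : A.1 ⊆ C.1) : p A * p C = p A := by
  rw [h.p_mul, show A ∩ C = A from Subtype.ext (Set.inter_eq_left.2 hAC)]

theorem p_mul_of_superset {A C : G.GenVertex} (hAC : A.1 ⊆ C.1) : p C * p A = p A := by
  rw [h.p_mul, show C ∩ A = A from Subtype.ext (Set.inter_eq_right.2 hAC)]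

theorem p_mul_of_disjoint {A C : G.GenVertex} (hAC : A.1 ∩ C.1 = ∅) : p A * p C = 0 := by
  rw [h.p_mul, show A ∩ C = ∅ from Subtype.ext hAC, h.p_empty]

theorem p_mul_vtx {A : G.GenVertex} {v : V} (hv : v ∈ A.1) : p A * p (G.vtx v) = p (G.vtx v) :=
  h.p_mul_of_superset (Set.singleton_subset_iff.2 hv)

theorem vtx_mul_p {A : G.GenVertex} {v : V} (hv : v ∈ A.1) : p (G.vtx v) * p A = p (G.vtx v) :=
  h.p_mul_of_subset (Set.singleton_subset_iff.2 hv)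

theorem p_mul_vtx_of_notMem {A : G.GenVertex} {v : V} (hv : v ∉ A.1) : p A * p (G.vtx v) = 0 :=
  h.p_mul_of_disjoint (Set.inter_singleton_eq_empty.2 hv)

theorem vtx_mul_p_of_notMem {A : G.GenVertex} {v : V} (hv : v ∉ A.1) : p (G.vtx v) * p A = 0 :=
  h.p_mul_of_disjoint (Set.singleton_inter_eq_empty.2 hv)

theorem p_mul_edge {A : G.GenVertex} {e : E} (he : G.source e ∈ A.1) : p A * s e = s e := by
  rw [← h.source_mul e, ← mul_assoc, h.p_mul_vtx he]

theorem p_mul_edge_of_notMem {A : G.GenVertex} {e : E} (he : G.source e ∉ A.1) :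
    p A * s e = 0 := by
  rw [← h.source_mul e, ← mul_assoc, h.p_mul_vtx_of_notMem he, zero_mul]

theorem ghost_mul_p {A : G.GenVertex} {e : E} (he : G.source e ∈ A.1) : t e * p A = t e := by
  rw [← h.ghost_mul_source e, mul_assoc, h.vtx_mul_p he]

theorem ghost_mul_p_of_notMem {A : G.GenVertex} {e : E} (he : G.source e ∉ A.1) :
    t e * p A = 0 := by
  rw [← h.ghost_mul_source e, mul_assoc, h.vtx_mul_p_of_notMem he, mul_zero]

theorem p_mul_edgeWord (A : G.GenVertex) {l : List E} (hl : l ≠ []) :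
    p A * edgeWord s l = edgeWord s l ∨ p A * edgeWord s l = 0 := by
  cases l with
  | nil => exact absurd rfl hl
  | cons e l =>
    by_cases he : G.source e ∈ A.1
    · left; rw [edgeWord_cons, ← mul_assoc, h.p_mul_edge he]
    · right; rw [edgeWord_cons, ← mul_assoc, h.p_mul_edge_of_notMem he, zero_mul]

theorem ghostWord_mul_p (A : G.GenVertex) {l : List E} (hl : l ≠ []) :
    ghostWord t l * p A = ghostWord t l ∨ ghostWord t l * p A = 0 := by
  cases l with
  | nil => exact absurd rfl hl
  | cons e l =>
    by_cases he : G.source e ∈ A.1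
    · left; rw [ghostWord_cons, mul_assoc, h.ghost_mul_p he]
    · right; rw [ghostWord_cons, mul_assoc, h.ghost_mul_p_of_notMem he, mul_zero]

theorem pathSource_mul_edgeWord (l : List E) (v : V) :
    p (G.vtx (G.pathSource l v)) * (edgeWord s l * p (G.vtx v)) = edgeWord s l * p (G.vtx v) := by
  cases l with
  | nil => simpa [pathSource] using h.p_mul_of_subset (Set.Subset.refl (G.vtx v).1)
  | cons e l => simp only [pathSource, edgeWord_cons, ← mul_assoc, h.source_mul]

theorem p_mul_edgeWord_vtx {A : G.GenVertex} {l : List E} {v : V}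
    (hl : G.pathSource l v ∈ A.1) :
    p A * (edgeWord s l * p (G.vtx v)) = edgeWord s l * p (G.vtx v) := by
  rw [← h.pathSource_mul_edgeWord, ← mul_assoc, h.p_mul_vtx hl]

theorem p_mul_edgeWord_vtx_of_notMem {A : G.GenVertex} {l : List E} {v : V}
    (hl : G.pathSource l v ∉ A.1) : p A * (edgeWord s l * p (G.vtx v)) = 0 := by
  rw [← h.pathSource_mul_edgeWord, ← mul_assoc, h.p_mul_vtx_of_notMem hl, zero_mul]

theorem edgeWord_mul_vtx_of_not_isPathTo {l : List E} {v : V} (hl : ¬ G.IsPathTo l v) :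
    edgeWord s l * p (G.vtx v) = 0 := by
  induction l with
  | nil => exact absurd trivial hl
  | cons e l ih =>
    rw [edgeWord_cons, mul_assoc]
    by_cases hl' : G.IsPathTo l v
    · rw [← h.mul_range, mul_assoc, h.p_mul_edgeWord_vtx_of_notMem (fun he => hl ⟨he, hl'⟩),
        mul_zero]
    · rw [ih hl', mul_zero]

theorem ghostWord_mul_edgeWord {l : List E} {v : V} (hl : G.IsPathTo l v) :
    ghostWord t l * (edgeWord s l * p (G.vtx v)) = p (G.vtx v) := by
  induction l with
  | nil => simp
  | cons e l ih =>
    rw [ghostWord_cons, edgeWord_cons, mul_assoc (s e), mul_assoc, ← mul_assoc (t e),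
      h.ghost_mul_self, h.p_mul_edgeWord_vtx hl.1, ih hl.2]

/-- The first edges at which the lists differ meet as `t e * s f = 0`. Cancelling a common edge
leaves `p (G.rng e)` in the middle; what remains of `l'` is nonempty, so this projection is absorbed
or kills the word. -/
theorem ghostWord_mul_edgeWord_eq_zero {l l' : List E} (h₁ : ¬ l <+: l') (h₂ : ¬ l' <+: l) :
    ghostWord t l * edgeWord s l' = 0 := by
  induction l generalizing l' with
  | nil => exact absurd l'.nil_prefix h₁
  | cons e l ih =>
    cases l' with
    | nil => exact absurd (e :: l).nil_prefix h₂
    | cons f l' =>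
      rw [ghostWord_cons, edgeWord_cons, mul_assoc, ← mul_assoc (t e)]
      by_cases hef : e = f
      · subst hef
        rw [h.ghost_mul_self]
        have h₂' : ¬ l' <+: l := fun hh => h₂ (List.cons_prefix_cons.2 ⟨rfl, hh⟩)
        have hl' : l' ≠ [] := by rintro rfl; exact h₂' l.nil_prefix
        rcases h.p_mul_edgeWord (G.rng e) hl' with hh | hh
        · rw [hh]
          exact ih (fun hh => h₁ (List.cons_prefix_cons.2 ⟨rfl, hh⟩)) h₂'
        · rw [hh, mul_zero]
      · rw [h.ghost_mul_of_ne e f hef, zero_mul, mul_zero]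

/-- The product of a ghost path with a path which is not shorter. -/
theorem ghostWord_mul_edgeWord_cases {l l' : List E} (hll : l.length ≤ l'.length) (v : V) :
    ghostWord t l * (edgeWord s l' * p (G.vtx v)) = 0 ∨
      ∃ m, l' = l ++ m ∧ G.IsPathTo m v ∧
        ghostWord t l * (edgeWord s l' * p (G.vtx v)) = edgeWord s m * p (G.vtx v) := by
  by_cases h₁ : l <+: l'
  · obtain ⟨m, rfl⟩ := h₁
    by_cases hp : G.IsPathTo (l ++ m) v
    · right
      rw [isPathTo_append] at hp
      refine ⟨m, rfl, hp.2, ?_⟩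
      rw [edgeWord_append, mul_assoc, ← h.pathSource_mul_edgeWord m, ← mul_assoc (edgeWord s l),
        ← mul_assoc, h.ghostWord_mul_edgeWord hp.1]
    · left; rw [h.edgeWord_mul_vtx_of_not_isPathTo hp, mul_zero]
  · left
    have h₂ : ¬ l' <+: l := fun hh => h₁ (hh.eq_of_length (le_antisymm hh.length_le hll) ▸
      List.prefix_refl _)
    rw [← mul_assoc, h.ghostWord_mul_edgeWord_eq_zero h₁ h₂, zero_mul]

/-- A path times `p A` can be written with a set `A` that is contained in the range of the path. -/
theorem exists_edgeWord_mul_p (l : List E) (A : G.GenVertex) :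
    ∃ C : G.GenVertex, (∀ v ∈ C.1, G.IsPathTo l v) ∧ edgeWord s l * p A = edgeWord s l * p C := by
  induction l with
  | nil => exact ⟨A, fun _ _ => trivial, rfl⟩
  | cons e l ih =>
    obtain ⟨C, hC, hAC⟩ := ih
    cases l with
    | nil =>
      refine ⟨G.rng e ∩ C, fun v hv => ⟨hv.1, trivial⟩, ?_⟩
      rw [edgeWord_cons, mul_assoc, hAC, ← h.p_mul, edgeWord_nil, one_mul, mul_one, ← mul_assoc,
        h.mul_range]
    | cons f l =>
      by_cases hf : G.source f ∈ G.range e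
      · exact ⟨C, fun v hv => ⟨hf, hC v hv⟩, by rw [edgeWord_cons, mul_assoc, hAC, ← mul_assoc]⟩
      -- The list is not a path, so its word vanishes.
      · refine ⟨∅, fun v hv => absurd hv (Set.notMem_empty v), ?_⟩
        rw [h.p_empty, mul_zero, edgeWord_cons, edgeWord_cons, ← h.mul_range, ← mul_assoc,
          mul_assoc (s e), h.p_mul_edge_of_notMem (A := G.rng e) hf, mul_zero, zero_mul, zero_mul]

end

end IsLeavittFamily

/-! ### Closed paths, cycles and exits -/

section Cycles

variable {V : Type*} {E : Type*} {G : Ultragraph V E}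

theorem IsPathTo.source_getElem_mem {l : List E} {v : V} (hl : G.IsPathTo l v) (i : ℕ)
    (hi : i + 1 < l.length) : G.source l[i + 1] ∈ G.range l[i] := by
  induction l generalizing i with
  | nil => simp at hi
  | cons e l ih =>
    cases i with
    | zero =>
      cases l with
      | nil => simp at hi
      | cons f l => exact hl.1
    | succ i => exact ih hl.2 i (by simpa using hi)

theorem IsPathTo.mem_range_getLast {l : List E} {v : V} (hl : G.IsPathTo l v) (hne : l ≠ []) :
    v ∈ G.range (l.getLast hne) := by
  induction l with
  | nil => exact absurd rfl hne
  | cons e l ih =>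
    cases l with
    | nil => exact hl.1
    | cons f l => exact ih hl.2 (by simp)

/-- A nonempty closed path at `v` of minimal length is a cycle. -/
theorem exists_isCycle {v : V}
    (hv : ∃ l : List E, l ≠ [] ∧ G.IsPathTo l v ∧ G.pathSource l v = v) :
    ∃ (k : ℕ) (c : Fin (k + 1) → E), G.IsCycle c ∧ G.source (c 0) = v ∧
      v ∈ G.range (c (Fin.last k)) := by
  obtain ⟨l, ⟨hl, hp, hs⟩, hmin⟩ := (measure (List.length (α := E))).wf.has_min
    {l : List E | l ≠ [] ∧ G.IsPathTo l v ∧ G.pathSource l v = v} hv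
  have hdist : ∀ i j (hij : i < j) (hj : j < l.length), G.source l[i] ≠ G.source l[j] := by
    intro i j hij hj heq
    have hsrc : ∀ n (hn : n < l.length), G.pathSource (l.drop n) v = G.source l[n] := by
      intro n hn
      rw [List.drop_eq_getElem_cons hn]; rfl
    have hi : i < l.length := hij.trans hj
    have e₁ : l.take i ++ l.drop i = l := List.take_append_drop i l
    have e₂ : l.take j ++ l.drop j = l := List.take_append_drop j l
    have hp₁ := hp
    rw [← e₁, isPathTo_append, hsrc i hi] at hp₁
    have hp₂ := hp
    rw [← e₂, isPathTo_append] at hp₂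
    have hs₁ := hs
    rw [← e₁, pathSource_append, hsrc i hi] at hs₁
    -- If two sources agree, cutting out the edges between them leaves a shorter closed path.
    refine hmin (l.take i ++ l.drop j) ⟨?_, ?_, ?_⟩ ?_
    · intro hnil
      have := congrArg List.length hnil
      simp at this; omega
    · rw [isPathTo_append, hsrc j hj, ← heq]; exact ⟨hp₁.1, hp₂.2⟩
    · rw [pathSource_append, hsrc j hj, ← heq]; exact hs₁
    · change (l.take i ++ l.drop j).length < l.length
      simp; omega
  have hpath := hp.source_getElem_mem
  have hlast := hp.mem_range_getLast hl
  cases l with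
  | nil => exact absurd rfl hl
  | cons e l =>
    have hlast' : v ∈ G.range ((e :: l).get (Fin.last l.length)) := by
      rw [List.getLast_eq_getElem] at hlast
      simpa using hlast
    refine ⟨l.length, (e :: l).get, ⟨⟨fun i => hpath i.1 (by simp), ?_⟩, ?_⟩, hs, hlast'⟩
    · rwa [show G.source ((e :: l).get 0) = v from hs]
    · intro i j hij
      rcases lt_or_gt_of_ne hij with hlt | hlt
      · exact hdist i.1 j.1 hlt j.2
      · exact (hdist j.1 i.1 hlt i.2).symm

theorem IsClosedPath.source_add_one_mem {k : ℕ} {c : Fin (k + 1) → E} (hc : G.IsClosedPath c)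
    (i : Fin (k + 1)) : G.source (c (i + 1)) ∈ G.range (c i) := by
  induction i using Fin.lastCases with
  | last => rw [Fin.last_add_one]; exact hc.2
  | cast i => rw [Fin.coeSucc_eq_succ]; exact hc.1 i

/-- The periodic sequence of edges given by a closed path. -/
def periodicSeq {k : ℕ} (c : Fin (k + 1) → E) (n : ℕ) : E := c (Fin.ofNat (k + 1) n)

/-- The list of the first `n` terms of a sequence of edges. -/
def initialSegment (a : ℕ → E) (n : ℕ) : List E := (List.range n).map a

theorem initialSegment_succ (a : ℕ → E) (n : ℕ) :
    initialSegment a (n + 1) = initialSegment a n ++ [a n] := by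
  simp [initialSegment, List.range_succ]

theorem periodicSeq_add {k : ℕ} (c : Fin (k + 1) → E) (n : ℕ) :
    periodicSeq c (n + (k + 1)) = periodicSeq c n := by
  simp [periodicSeq, Fin.ofNat]

theorem periodicSeq_mul_add {k : ℕ} (c : Fin (k + 1) → E) (m n : ℕ) :
    periodicSeq c (m * (k + 1) + n) = periodicSeq c n := by
  simp [periodicSeq, Fin.ofNat]

theorem periodicSeq_val {k : ℕ} (c : Fin (k + 1) → E) (i : Fin (k + 1)) :
    periodicSeq c i = c i := by
  simp [periodicSeq]

theorem periodicSeq_succ {k : ℕ} (c : Fin (k + 1) → E) (n : ℕ) :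
    periodicSeq c (n + 1) = c (Fin.ofNat (k + 1) n + 1) := by
  unfold periodicSeq
  congr 1
  ext
  simp [Fin.val_add]

theorem IsClosedPath.source_periodicSeq_mem {k : ℕ} {c : Fin (k + 1) → E}
    (hc : G.IsClosedPath c) (n : ℕ) :
    G.source (periodicSeq c (n + 1)) ∈ G.range (periodicSeq c n) := by
  rw [periodicSeq_succ]
  exact hc.source_add_one_mem _

theorem isPathTo_initialSegment {a : ℕ → E} (ha : ∀ n, G.source (a (n + 1)) ∈ G.range (a n))
    (n : ℕ) {w : V} (hw : w ∈ G.range (a n)) : G.IsPathTo (initialSegment a (n + 1)) w := by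
  induction n generalizing w with
  | zero => exact ⟨hw, trivial⟩
  | succ n ih =>
    rw [initialSegment_succ, isPathTo_append]
    exact ⟨ih (ha n), hw, trivial⟩

theorem pathSource_initialSegment (a : ℕ → E) (n : ℕ) (w : V) :
    G.pathSource (initialSegment a (n + 1)) w = G.source (a 0) := by
  simp [initialSegment, List.range_succ_eq_map, pathSource]

theorem initialSegment_getElem? (a : ℕ → E) {n j : ℕ} (hj : j < n) :
    (initialSegment a n)[j]? = some (a j) := by
  simp [initialSegment, hj]

/-- A path that leaves a closed path after a long time has no short period. -/
theorem append_ne_append_of_exit {a : ℕ → E} {K : ℕ} (ha : ∀ n, a (n + K) = a n) (hK : 0 < K)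
    {n : ℕ} {e : E} (he : e ≠ a n) {l : List E} (hl : l ≠ []) (hn : l.length + K ≤ n)
    (m : List E) :
    l ++ (initialSegment a n ++ [e]) ≠ initialSegment a n ++ [e] ++ m := by
  intro heq
  have hlen : (initialSegment a n).length = n := by simp [initialSegment]
  have hl0 : 0 < l.length := List.length_pos_iff.2 hl
  have key : ∀ j, j + l.length ≤ n →
      (initialSegment a n ++ [e])[j]? = (initialSegment a n ++ [e])[j + l.length]? := by
    intro j hj
    have := congrArg (fun x : List E => x[j + l.length]?) heq
    beta_reduce at this
    rw [List.getElem?_append_right (by omega), List.getElem?_append_left (l₂ := m) (by simp [hlen]; omega),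
      Nat.add_sub_cancel] at this
    exact this
  have hlt : ∀ j, j < n → (initialSegment a n ++ [e])[j]? = some (a j) := by
    intro j hj
    rw [List.getElem?_append_left (by omega), initialSegment_getElem? a hj]
  -- Shifting by `l.length` identifies `e`, at position `n`, with `a (n - l.length)`. The same shift
  -- one period earlier involves only terms of `a`, and comparing the two gives `e = a n`.
  have h₁ := key (n - l.length) (by omega)
  rw [hlt _ (by omega), show n - l.length + l.length = n by omega,
    List.getElem?_append_right (by omega)] at h₁
  have h₂ := key (n - l.length - K) (by omega)
  rw [hlt _ (by omega), show n - l.length - K + l.length = n - K by omega, hlt _ (by omega)] at h₂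
  have h₃ := ha (n - l.length - K)
  have h₄ := ha (n - K)
  rw [show n - l.length - K + K = n - l.length by omega] at h₃
  rw [show n - K + K = n by omega] at h₄
  simp [hlen] at h₁
  simp at h₂
  exact he (by rw [← h₁, h₃, h₂, h₄])

/-- Since `w` is not a sink, it emits an edge, and the only edge allowed is the next one of `c`. -/
theorem IsClosedPath.eq_of_not_hasExit {k : ℕ} {c : Fin (k + 1) → E} (hc : ¬ G.HasExit c)
    {i : Fin (k + 1)} {w : V} (hw : w ∈ G.range (c i)) : w = G.source (c (i + 1)) := by
  simp only [HasExit, not_or, not_exists, not_and, not_not] at hc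
  have hs : ¬ G.IsSink w := fun hs => hc.2 i w hs hw
  simp only [IsSink, ne_eq, not_forall, not_not] at hs
  obtain ⟨e, rfl⟩ := hs
  rw [hc.1 i e hw]

theorem rng_last_eq_vtx {k : ℕ} {c : Fin (k + 1) → E} (hc : G.IsClosedPath c)
    (he : ¬ G.HasExit c) : G.rng (c (Fin.last k)) = G.vtx (G.source (c 0)) := by
  refine Subtype.ext (Set.Subset.antisymm (fun w hw => ?_) (Set.singleton_subset_iff.2 hc.2))
  have := IsClosedPath.eq_of_not_hasExit he hw
  rwa [Fin.last_add_one] at this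

/-- The paths that start at the base of a cycle without exit are initial segments of the powers
of the cycle. -/
theorem eq_initialSegment_of_not_hasExit {k : ℕ} {c : Fin (k + 1) → E} (hc : G.IsClosedPath c)
    (he : ¬ G.HasExit c) (l : List E) {w : V} (hl : G.IsPathTo l w)
    (hs : G.pathSource l w = G.source (c 0)) :
    l = initialSegment (periodicSeq c) l.length ∧ w = G.source (periodicSeq c l.length) := by
  induction l using List.reverseRecOn generalizing w with
  | nil => exact ⟨rfl, hs⟩
  | append_singleton l e ih =>
    rw [isPathTo_append] at hl
    rw [pathSource_append] at hs
    obtain ⟨ih₁, ih₂⟩ := ih hl.1 hs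
    have hle : e = periodicSeq c l.length := by
      -- Modulo `k + 1`, the index `l.length + k` is the predecessor of `l.length`; this also covers
      -- the empty list.
      have h₁ := hc.source_periodicSeq_mem (l.length + k)
      rw [add_assoc, periodicSeq_add, ← ih₂] at h₁
      simp only [HasExit, not_or, not_exists, not_and, not_not] at he
      have h₂ := he.1 _ e h₁
      rw [← periodicSeq_succ c, add_assoc, periodicSeq_add] at h₂
      exact h₂
    rw [List.length_append, List.length_singleton, initialSegment_succ, ← ih₁, ← hle]
    refine ⟨rfl, ?_⟩
    have hw : w ∈ G.range e := hl.2.1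
    rw [hle] at hw
    rw [periodicSeq_succ]
    exact IsClosedPath.eq_of_not_hasExit he hw

theorem initialSegment_periodicSeq {k : ℕ} (c : Fin (k + 1) → E) :
    initialSegment (periodicSeq c) (k + 1) = List.ofFn c := by
  apply List.ext_getElem
  · simp [initialSegment]
  · intro i h₁ h₂
    have hi : i < k + 1 := by simpa using h₂
    simpa [initialSegment, -List.ofFn_succ] using periodicSeq_val c ⟨i, hi⟩

theorem edgeWord_initialSegment_mul {U : Type*} [Ring U] (s : E → U) {k : ℕ}
    (c : Fin (k + 1) → E) (m : ℕ) :
    edgeWord s (initialSegment (periodicSeq c) (m * (k + 1))) = edgeWord s (List.ofFn c) ^ m := by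
  induction m with
  | zero => simp [initialSegment]
  | succ m ih =>
    have : initialSegment (periodicSeq c) ((m + 1) * (k + 1)) =
        initialSegment (periodicSeq c) (m * (k + 1)) ++ initialSegment (periodicSeq c) (k + 1) := by
      rw [Nat.succ_mul]
      simp [initialSegment, List.range_add, periodicSeq_mul_add]
    rw [this, edgeWord_append, ih, initialSegment_periodicSeq, pow_succ]

/-- The closed paths at the base of a cycle without exit are powers of the cycle. -/
theorem exists_edgeWord_eq_pow {U : Type*} [Ring U] (s : E → U) {k : ℕ} {c : Fin (k + 1) → E}
    (hc : G.IsCycle c) (he : ¬ G.HasExit c) {l : List E} (hne : l ≠ [])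
    (hl : G.IsPathTo l (G.source (c 0)))
    (hs : G.pathSource l (G.source (c 0)) = G.source (c 0)) :
    ∃ m, edgeWord s l = edgeWord s (List.ofFn c) ^ (m + 1) := by
  obtain ⟨h₁, h₂⟩ := eq_initialSegment_of_not_hasExit hc.1 he l hl hs
  -- The sources on a cycle are distinct, so a path can be back at the base only after full turns.
  have h₃ : (0 : Fin (k + 1)) = Fin.ofNat (k + 1) l.length := by
    by_contra hne'
    exact hc.2 _ _ hne' h₂
  have h₄ : l.length % (k + 1) = 0 := by
    simpa [Fin.ofNat] using (congrArg Fin.val h₃).symm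
  obtain ⟨m, hm⟩ := Nat.dvd_of_mod_eq_zero h₄
  have hl0 : 0 < l.length := List.length_pos_iff.2 hne
  cases m with
  | zero => omega
  | succ m =>
    refine ⟨m, ?_⟩
    rw [h₁, hm, mul_comm, edgeWord_initialSegment_mul]

end Cycles


/-! ### Constant terms at a vertex and independence of paths -/

section Uniqueness

variable {V : Type*} {E : Type*} {G : Ultragraph V E} {R : Type*} [CommRing R]
variable {U : Type*} [Ring U] [Algebra R U] {W : Type*} [Ring W] [Algebra R W]

variable (G R) in
/-- The span of the nonempty closed paths at `v`. -/
def closedSpan (p : G.GenVertex → U) (s : E → U) (v : V) : Submodule R U :=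
  Submodule.span R {x | ∃ l, l ≠ [] ∧ G.IsPathTo l v ∧ G.pathSource l v = v ∧
    x = edgeWord s l * p (G.vtx v)}

variable (G R) in
/-- A homomorphism that kills no nonzero multiple of a vertex, and no polynomial with nonzero
constant term in a cycle without exit. -/
structure IsReductionFaithful (p : G.GenVertex → U) (s : E → U) (Φ : U →ₐ[R] W) : Prop where
  vtx : ∀ (v : V) (r : R), Φ (r • p (G.vtx v)) = 0 → r = 0
  cycle : ∀ (k : ℕ) (c : Fin (k + 1) → E), G.IsCycle c → ¬ G.HasExit c → ∀ (r : R),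
    ∀ y ∈ Submodule.span R (Set.range fun m : ℕ =>
      edgeWord s (List.ofFn c) ^ (m + 1) * p (G.rng (c (Fin.last k)))),
    Φ (r • p (G.rng (c (Fin.last k))) + y) = 0 → r = 0

variable {p : G.GenVertex → U} {s t : E → U} (h : G.IsLeavittFamily p s t)
variable {Φ : U →ₐ[R] W} (hΦ : G.IsReductionFaithful R p s Φ)

include h hΦ

/-- A sequence of paths that start at `v` and eventually avoid all closed paths at `v` excludes
nonzero constant terms. -/
theorem IsReductionFaithful.eq_zero_of_avoiding {v : V} (δ : ℕ → List E) (w : V)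
    (hδ : ∀ n, G.IsPathTo (δ n) w) (hδv : ∀ n, G.pathSource (δ n) w = v)
    (havoid : ∀ l : List E, l ≠ [] → ∃ N, ∀ n ≥ N, ∀ m, l ++ δ n = δ n ++ m →
      G.IsPathTo m w → G.pathSource m w ≠ w)
    {r : R} {y : U} (hy : y ∈ closedSpan G R p s v) (hr : Φ (r • p (G.vtx v) + y) = 0) :
    r = 0 := by
  let a : ℕ → U := fun n => p (G.vtx w) * ghostWord t (δ n)
  let b : ℕ → U := fun n => edgeWord s (δ n) * p (G.vtx w)
  have hvb : ∀ n, p (G.vtx v) * b n = b n := by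
    intro n
    rw [← hδv n]
    exact h.pathSource_mul_edgeWord _ _
  have hab : ∀ n, a n * b n = p (G.vtx w) := by
    intro n
    simp only [a, b]
    rw [mul_assoc, h.ghostWord_mul_edgeWord (hδ n), h.p_mul_of_subset (Set.Subset.refl _)]
  have key : ∃ N, ∀ n ≥ N, a n * y * b n = 0 := by
    clear hr
    induction hy using Submodule.span_induction with
    | mem x hx =>
      obtain ⟨l, hl, -, -, rfl⟩ := hx
      obtain ⟨N, hN⟩ := havoid l hl
      refine ⟨N, fun n hn => ?_⟩
      rw [mul_assoc, mul_assoc, mul_assoc, hvb]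
      simp only [b]
      rw [← mul_assoc (edgeWord s l), ← edgeWord_append]
      -- The compressed closed path is zero or `s_m` with `l ++ δ n = δ n ++ m`; in the second case
      -- `p_w` kills it on the left, as `m` does not start at `w`.
      rcases h.ghostWord_mul_edgeWord_cases (l := δ n) (l' := l ++ δ n) (by simp) w with h0 | h0
      · rw [h0, mul_zero]
      · obtain ⟨m, hm, hmw, h0⟩ := h0
        rw [h0]
        exact h.p_mul_edgeWord_vtx_of_notMem (hN n hn m hm hmw)
    | zero => exact ⟨0, by simp⟩
    | add x y _ _ hx hy =>
      obtain ⟨N, hN⟩ := hx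
      obtain ⟨M, hM⟩ := hy
      refine ⟨max N M, fun n hn => ?_⟩
      rw [mul_add, add_mul, hN n (le_of_max_le_left hn), hM n (le_of_max_le_right hn), add_zero]
    | smul c x _ hx =>
      obtain ⟨N, hN⟩ := hx
      refine ⟨N, fun n hn => ?_⟩
      rw [mul_smul_comm, smul_mul_assoc, hN n hn, smul_zero]
  obtain ⟨N, hN⟩ := key
  refine hΦ.vtx w r ?_
  have : r • p (G.vtx w) = a N * (r • p (G.vtx v) + y) * b N := by
    rw [mul_add, add_mul, hN N le_rfl, add_zero, mul_smul_comm, smul_mul_assoc, mul_assoc, hvb,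
      hab]
  rw [this, map_mul, map_mul, hr, mul_zero, zero_mul]

/-- If there is a closed path at `v`, a shortest one is a cycle. An exit of it provides paths out of
`v` to which `eq_zero_of_avoiding` applies; without exit, `y` is a polynomial in the cycle without
constant term. If there is no closed path at `v`, the empty path is avoiding. -/
theorem IsReductionFaithful.eq_zero_of_closedSpan {v : V} {r : R} {y : U}
    (hy : y ∈ closedSpan G R p s v) (hr : Φ (r • p (G.vtx v) + y) = 0) : r = 0 := by
  by_cases hv : ∃ l : List E, l ≠ [] ∧ G.IsPathTo l v ∧ G.pathSource l v = v
  · obtain ⟨k, c, hc, rfl, hv'⟩ := exists_isCycle hv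
    by_cases he : G.HasExit c
    · have hval : ∀ i : Fin (k + 1), Fin.ofNat (k + 1) i = i := fun i => by simp
      have h0 : periodicSeq c 0 = c 0 := periodicSeq_val c 0
      rcases he with ⟨i, e, hei, hec⟩ | ⟨i, w, hw, hwi⟩
      · obtain ⟨w, hw⟩ := G.range_nonempty e
        refine hΦ.eq_zero_of_avoiding h
          -- After `n` full turns, `i + 1` further edges end with `c i`, where `e` leaves the cycle.
          (fun n => initialSegment (periodicSeq c) (n * (k + 1) + i + 1) ++ [e]) w
          (fun n => ?_) (fun n => ?_) (fun l hl => ⟨l.length + (k + 1), fun n hn m hm _ => ?_⟩) hy hr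
        · rw [isPathTo_append]
          refine ⟨isPathTo_initialSegment hc.1.source_periodicSeq_mem _ ?_, hw, trivial⟩
          rw [periodicSeq_mul_add, periodicSeq_val]
          exact hei
        · rw [pathSource_append, pathSource_initialSegment, h0]
        · refine absurd hm (append_ne_append_of_exit (periodicSeq_add c) k.succ_pos ?_ hl ?_ m)
          · rw [add_assoc, periodicSeq_mul_add, periodicSeq_succ, hval]
            exact hec
          · have : n * 1 ≤ n * (k + 1) := Nat.mul_le_mul_left n (by omega)
            omega
      -- A path that ends at a sink cannot be continued by a nonempty `m` starting there, so no
      -- winding is needed.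
      · refine hΦ.eq_zero_of_avoiding h (fun _ => initialSegment (periodicSeq c) (i + 1)) w
          (fun n => ?_) (fun n => ?_) (fun l hl => ⟨0, fun n hn m hm _ => ?_⟩) hy hr
        · refine isPathTo_initialSegment hc.1.source_periodicSeq_mem _ ?_
          rwa [periodicSeq_val]
        · rw [pathSource_initialSegment, h0]
        · cases m with
          | nil =>
            have := congrArg List.length hm
            simp at this
            exact absurd this hl
          | cons f m => exact hw f
    · refine hΦ.cycle k c hc he r y ?_ ?_
      · rw [rng_last_eq_vtx hc.1 he]
        refine Submodule.span_le.2 ?_ hy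
        rintro x ⟨l, hl, hlp, hls, rfl⟩
        obtain ⟨m, hm⟩ := exists_edgeWord_eq_pow s hc he hl hlp hls
        rw [hm]
        exact Submodule.subset_span ⟨m, rfl⟩
      · rwa [rng_last_eq_vtx hc.1 he]
  · refine hΦ.eq_zero_of_avoiding h (fun _ => []) v (fun _ => trivial) (fun _ => rfl)
      (fun l hl => ⟨0, fun n hn m hm hm' hs => hv ⟨m, ?_, hm', hs⟩⟩) hy hr
    rintro rfl
    exact hl (by simpa using hm)

/-- Paths whose ranges contain `v` are linearly independent modulo the kernel. -/
theorem IsReductionFaithful.paths_independent {v : V} (S : Finset (List E)) (c : List E → R)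
    (hc : ∀ l ∈ S, c l ≠ 0 → G.IsPathTo l v)
    (hS : Φ (∑ l ∈ S, c l • (edgeWord s l * p (G.vtx v))) = 0) : ∀ l ∈ S, c l = 0 := by
  classical
  by_contra! hne
  obtain ⟨l₁, hl₁, hcl₁⟩ := hne
  -- Multiplying by `p_v s_l^*` turns the term of a shortest `l` into `c l • p_v`. Every other term
  -- survives only if its path is `l ++ γ` with `γ` a nonempty closed path at `v`.
  obtain ⟨l, hl, hmin⟩ := (S.filter fun l => c l ≠ 0).exists_min_image List.length
    ⟨l₁, Finset.mem_filter.2 ⟨hl₁, hcl₁⟩⟩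
  rw [Finset.mem_filter] at hl
  have hlv := hc l hl.1 hl.2
  refine hl.2 (hΦ.eq_zero_of_closedSpan h (v := v) (r := c l)
    (y := ∑ m ∈ S.erase l, c m • (p (G.vtx v) * (ghostWord t l * (edgeWord s m * p (G.vtx v)))))
    (Submodule.sum_mem _ fun m hm => ?_) ?_)
  · rw [Finset.mem_erase] at hm
    by_cases hcm : c m = 0
    · rw [hcm, zero_smul]; exact Submodule.zero_mem _
    · refine Submodule.smul_mem _ _ ?_
      rcases h.ghostWord_mul_edgeWord_cases (hmin m (Finset.mem_filter.2 ⟨hm.2, hcm⟩)) v with h0 | h0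
      · rw [h0, mul_zero]; exact Submodule.zero_mem _
      · obtain ⟨γ, rfl, hγ, h0⟩ := h0
        rw [h0]
        by_cases hγv : G.pathSource γ v = v
        · rw [h.p_mul_edgeWord_vtx (A := G.vtx v) hγv]
          refine Submodule.subset_span ⟨γ, ?_, hγ, hγv, rfl⟩
          rintro rfl
          exact hm.1 (List.append_nil l)
        · rw [h.p_mul_edgeWord_vtx_of_notMem (A := G.vtx v) hγv]
          exact Submodule.zero_mem _
  · have : c l • p (G.vtx v) + ∑ m ∈ S.erase l,
        c m • (p (G.vtx v) * (ghostWord t l * (edgeWord s m * p (G.vtx v)))) =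
        p (G.vtx v) * ghostWord t l * ∑ m ∈ S, c m • (edgeWord s m * p (G.vtx v)) := by
      rw [← Finset.add_sum_erase S _ hl.1, mul_add, Finset.mul_sum]
      congr 1
      · rw [mul_smul_comm, mul_assoc, h.ghostWord_mul_edgeWord hlv,
          h.p_mul_of_subset (Set.Subset.refl _)]
      · refine Finset.sum_congr rfl fun m _ => ?_
        rw [mul_smul_comm, mul_assoc]
    rw [this, map_mul, hS, mul_zero]

end Uniqueness


/-! ### Combinations of words without ghost edges -/

section Uniqueness

variable {V : Type*} {E : Type*} {G : Ultragraph V E} {R : Type*} [CommRing R]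
variable {U : Type*} [Ring U] [Algebra R U] {W : Type*} [Ring W] [Algebra R W]

open scoped Classical in
/-- A linear combination of the projections `p A` vanishes on `B \ C` if the corresponding
combination of indicator functions does. -/
theorem IsLeavittFamily.sum_p_mul_eq_zero_of_indicator {p : G.GenVertex → U} {s t : E → U}
    (h : G.IsLeavittFamily p s t) {ι : Type*} (T : Finset ι) (c : ι → R) (A : ι → G.GenVertex) :
    ∀ (r : R) (B C : G.GenVertex),
      (∀ v ∈ B.1, v ∉ C.1 → r + ∑ i ∈ T, (if v ∈ (A i).1 then c i else 0) = 0) →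
      r • (p B - p (B ∩ C)) + ∑ i ∈ T, c i • (p (A i) * (p B - p (B ∩ C))) = 0 := by
  induction T using Finset.induction_on with
  | empty =>
    intro r B C hr
    simp only [Finset.sum_empty, add_zero] at hr ⊢
    by_cases hBC : B.1 ⊆ C.1
    · rw [show B ∩ C = B from Subtype.ext (Set.inter_eq_left.2 hBC), sub_self, smul_zero]
    · obtain ⟨v, hv, hv'⟩ := Set.not_subset.1 hBC
      rw [hr v hv hv', zero_smul]
  | insert i T hi ih =>
    intro r B C hr
    -- The set `B \ C` need not be a generalized vertex, so `p B - p (B ∩ C)` plays its role. It is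
    -- split along `A i`: inside, `c i` joins the constant `r`; outside, `A i` joins the excluded
    -- set.
    have h₁ := ih (r + c i) (B ∩ A i) C fun v hv hvC => by
      have := hr v hv.1 hvC
      rw [Finset.sum_insert hi, if_pos hv.2] at this
      rw [add_assoc, this]
    have h₂ := ih r B (A i ∪ C) fun v hv hvC => by
      have := hr v hv fun hh => hvC (Or.inr hh)
      rwa [Finset.sum_insert hi, if_neg fun hh => hvC (Or.inl hh), zero_add] at this
    have e₁ : p (B ∩ (A i ∪ C)) = p (B ∩ A i) + p (B ∩ C) - p (B ∩ A i ∩ C) := by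
      have e₂ : B ∩ (A i ∪ C) = (B ∩ A i) ∪ (B ∩ C) := Subtype.ext (Set.inter_union_distrib_left ..)
      have e₃ : (B ∩ A i) ∩ (B ∩ C) = B ∩ A i ∩ C :=
        Subtype.ext ((Set.inter_inter_distrib_left B.1 (A i).1 C.1).symm.trans
          (Set.inter_assoc _ _ _).symm)
      rw [e₂, h.p_union, e₃]
    have e₄ : p (A i) * (p B - p (B ∩ C)) = p (B ∩ A i) - p (B ∩ A i ∩ C) := by
      rw [mul_sub, h.p_mul, h.p_mul]
      congr 2
      · exact Subtype.ext (Set.inter_comm _ _)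
      · refine Subtype.ext ?_
        change (A i).1 ∩ (B.1 ∩ C.1) = B.1 ∩ (A i).1 ∩ C.1
        rw [← Set.inter_assoc, Set.inter_comm (A i).1]
    have e₅ : p B - p (B ∩ C) =
        (p (B ∩ A i) - p (B ∩ A i ∩ C)) + (p B - p (B ∩ (A i ∪ C))) := by
      rw [e₁]; abel
    rw [Finset.sum_insert hi, e₄, ← add_zero (0 : U)]
    nth_rewrite 1 [← h₁]
    nth_rewrite 1 [← h₂]
    simp only [e₅, mul_add, smul_add, Finset.sum_add_distrib, add_smul]
    abel

variable (G R) in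
/-- The span of the words `s_α p_A s_β^*` with `β` of length at most `n`. -/
def wordSpan (p : G.GenVertex → U) (s t : E → U) (n : ℕ) : Submodule R U :=
  Submodule.span R {x | ∃ (l : List E) (A : G.GenVertex) (l' : List E), l'.length ≤ n ∧
    x = edgeWord s l * p A * ghostWord t l'}

variable {p : G.GenVertex → U} {s t : E → U} (h : G.IsLeavittFamily p s t)
variable {Φ : U →ₐ[R] W} (hΦ : G.IsReductionFaithful R p s Φ)

theorem wordSpan_mono {m n : ℕ} (hmn : m ≤ n) : wordSpan G R p s t m ≤ wordSpan G R p s t n :=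
  Submodule.span_mono fun _ ⟨l, A, l', hl', hx⟩ => ⟨l, A, l', hl'.trans hmn, hx⟩

theorem mem_wordSpan (l : List E) (A : G.GenVertex) (l' : List E) {n : ℕ} (hn : l'.length ≤ n) :
    edgeWord s l * p A * ghostWord t l' ∈ wordSpan G R p s t n :=
  Submodule.subset_span ⟨l, A, l', hn, rfl⟩

theorem mem_wordSpan_zero (l : List E) (A : G.GenVertex) :
    edgeWord s l * p A ∈ wordSpan G R p s t 0 := by
  simpa using mem_wordSpan (R := R) (p := p) (s := s) (t := t) l A [] le_rfl

include h

theorem IsLeavittFamily.exists_sum_of_mem_wordSpan_zero {x : U} (hx : x ∈ wordSpan G R p s t 0) :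
    ∃ (T : Finset (List E × G.GenVertex)) (c : List E × G.GenVertex → R),
      (∀ i ∈ T, ∀ v ∈ i.2.1, G.IsPathTo i.1 v) ∧
      x = ∑ i ∈ T, c i • (edgeWord s i.1 * p i.2) := by
  have hle : wordSpan G R p s t 0 ≤ Submodule.span R
      ((fun i : List E × G.GenVertex => edgeWord s i.1 * p i.2) ''
        {i | ∀ v ∈ i.2.1, G.IsPathTo i.1 v}) := by
    refine Submodule.span_le.2 ?_
    rintro x ⟨l, A, l', hl', rfl⟩
    rw [List.length_eq_zero_iff.1 (Nat.le_zero.1 hl'), ghostWord_nil, mul_one]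
    obtain ⟨C, hC, hAC⟩ := h.exists_edgeWord_mul_p l A
    rw [hAC]
    exact Submodule.subset_span ⟨(l, C), hC, rfl⟩
  obtain ⟨c, hc, rfl⟩ := (Finsupp.mem_span_image_iff_linearCombination R).1 (hle hx)
  exact ⟨c.support, c, fun i hi => (Finsupp.mem_supported R c).1 hc hi, rfl⟩

open scoped Classical in
-- Multiplying by `p_v` evaluates at `v`: the coefficient of a path `l` becomes the value at `v` of
-- the function `∑ c_i 1_{A_i}` over the terms with path `l`.
theorem IsLeavittFamily.sum_mul_vtx (T : Finset (List E × G.GenVertex))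
    (c : List E × G.GenVertex → R) (v : V) :
    (∑ i ∈ T, c i • (edgeWord s i.1 * p i.2)) * p (G.vtx v) =
      ∑ l ∈ T.image Prod.fst, (∑ i ∈ T with i.1 = l, if v ∈ i.2.1 then c i else 0) •
        (edgeWord s l * p (G.vtx v)) := by
  rw [Finset.sum_mul, ← Finset.sum_fiberwise_of_maps_to (t := T.image Prod.fst) (g := Prod.fst)
    fun i hi => Finset.mem_image_of_mem _ hi]
  refine Finset.sum_congr rfl fun l _ => ?_
  rw [Finset.sum_smul]
  refine Finset.sum_congr rfl fun i hi => ?_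
  rw [Finset.mem_filter] at hi
  rw [smul_mul_assoc, mul_assoc, ← hi.2]
  by_cases hv : v ∈ i.2.1
  · rw [if_pos hv, h.p_mul_vtx hv]
  · rw [if_neg hv, h.p_mul_vtx_of_notMem hv, mul_zero, smul_zero, zero_smul]

omit h in
open scoped Classical in
theorem isPathTo_of_sum_ne_zero {T : Finset (List E × G.GenVertex)}
    {c : List E × G.GenVertex → R} (hT : ∀ i ∈ T, ∀ v ∈ i.2.1, G.IsPathTo i.1 v) {v : V}
    {l : List E} (hl : (∑ i ∈ T with i.1 = l, if v ∈ i.2.1 then c i else 0) ≠ 0) :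
    G.IsPathTo l v := by
  obtain ⟨i, hi, hne⟩ := Finset.exists_ne_zero_of_sum_ne_zero hl
  rw [Finset.mem_filter] at hi
  have hv : v ∈ i.2.1 := by
    by_contra hv
    exact hne (if_neg hv)
  exact hi.2 ▸ hT i hi.1 v hv

include hΦ

/-- Independence of paths at each `v` makes the combination of indicator functions attached to each
path vanish pointwise, and the relations for unions and intersections then make the combination of
projections vanish. -/
theorem IsReductionFaithful.eq_zero_of_mem_wordSpan_zero {x : U}
    (hx : x ∈ wordSpan G R p s t 0) (hx0 : Φ x = 0) : x = 0 := by
  classical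
  obtain ⟨T, c, hT, rfl⟩ := h.exists_sum_of_mem_wordSpan_zero hx
  have key : ∀ l ∈ T.image Prod.fst, ∀ v,
      (∑ i ∈ T with i.1 = l, if v ∈ i.2.1 then c i else 0) = 0 := by
    intro l hl v
    refine hΦ.paths_independent h (v := v) (T.image Prod.fst)
      (fun l => ∑ i ∈ T with i.1 = l, if v ∈ i.2.1 then c i else 0)
      (fun l _ hl => isPathTo_of_sum_ne_zero hT hl) ?_ l hl
    rw [← h.sum_mul_vtx, map_mul, hx0, zero_mul]
  rw [← Finset.sum_fiberwise_of_maps_to (t := T.image Prod.fst) (g := Prod.fst)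
    fun i hi => Finset.mem_image_of_mem _ hi]
  refine Finset.sum_eq_zero fun l hl => ?_
  -- The whole vertex set need not be a generalized vertex; a finite union `B` acts as a unit on the
  -- projections involved.
  have hBex : ∀ S : Finset (List E × G.GenVertex), ∃ B : G.GenVertex, ∀ i ∈ S, i.2.1 ⊆ B.1 := by
    intro S
    induction S using Finset.induction_on with
    | empty => exact ⟨∅, by simp⟩
    | insert i S _ ih =>
      obtain ⟨B, hB⟩ := ih
      refine ⟨i.2 ∪ B, fun j hj => ?_⟩
      rcases Finset.mem_insert.1 hj with rfl | hj
      · exact Set.subset_union_left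
      · exact (hB j hj).trans Set.subset_union_right
  obtain ⟨B, hB⟩ := hBex (T.filter fun i => i.1 = l)
  have := h.sum_p_mul_eq_zero_of_indicator (T.filter fun i => i.1 = l) c (fun i => i.2) 0 B ∅
    fun v _ _ => by rw [zero_add]; exact key l hl v
  rw [show B ∩ ∅ = (∅ : G.GenVertex) from Subtype.ext (Set.inter_empty _), h.p_empty, sub_zero,
    zero_smul, zero_add] at this
  calc ∑ i ∈ T with i.1 = l, c i • (edgeWord s i.1 * p i.2)
      = edgeWord s l * ∑ i ∈ T with i.1 = l, c i • (p i.2 * p B) := by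
        rw [Finset.mul_sum]
        refine Finset.sum_congr rfl fun i hi => ?_
        rw [h.p_mul_of_subset (hB i hi), (Finset.mem_filter.1 hi).2, mul_smul_comm]
    _ = 0 := by rw [this, mul_zero]

/-- If `x p_v` is annihilated by infinitely many edges that start at `v`, then it is zero. -/
theorem IsReductionFaithful.mul_vtx_eq_zero {v : V} (hv : {e | G.source e = v}.Infinite) {x : U}
    (hx : x ∈ wordSpan G R p s t 0) (S : Finset E)
    (hxS : ∀ e ∉ S, G.source e = v → x * s e = 0) : x * p (G.vtx v) = 0 := by
  classical
  obtain ⟨T, c, hT, rfl⟩ := h.exists_sum_of_mem_wordSpan_zero hx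
  -- An edge `f` on none of the paths in `T` makes the extended paths `l ++ [f]` pairwise
  -- incomparable as prefixes, so each ghost path of `l ++ [f]` isolates one coefficient.
  obtain ⟨f, hf, hfS⟩ := hv.exists_notMem_finset
    (S ∪ (T.image Prod.fst).biUnion List.toFinset)
  change G.source f = v at hf
  rw [Finset.mem_union, not_or] at hfS
  have hfl : ∀ l ∈ T.image Prod.fst, f ∉ l := fun l hl hfl =>
    hfS.2 (Finset.mem_biUnion.2 ⟨l, hl, List.mem_toFinset.2 hfl⟩)
  have h0 := hxS f hfS.1 hf
  obtain ⟨w, hw⟩ := G.range_nonempty f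
  rw [← h.source_mul, hf, ← mul_assoc] at h0
  rw [h.sum_mul_vtx] at h0 ⊢
  refine Finset.sum_eq_zero fun l hl => ?_
  by_cases hcl : (∑ i ∈ T with i.1 = l, if v ∈ i.2.1 then c i else 0) = 0
  · rw [hcl, zero_smul]
  exfalso
  have hlp := isPathTo_of_sum_ne_zero hT hcl
  refine hcl (hΦ.vtx w _ ?_)
  have hlf : G.IsPathTo (l ++ [f]) w := by
    rw [isPathTo_append]
    exact ⟨by change G.IsPathTo l (G.source f); rwa [hf], hw, trivial⟩
  have h1 := congrArg (fun y => ghostWord t (l ++ [f]) * (y * p (G.vtx w))) h0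
  simp only [zero_mul, mul_zero] at h1
  rw [Finset.sum_mul, Finset.sum_mul, Finset.mul_sum, Finset.sum_eq_single l] at h1
  · rw [smul_mul_assoc, smul_mul_assoc, mul_smul_comm] at h1
    rw [mul_assoc (edgeWord s l), ← hf, h.source_mul,
      show edgeWord s l * s f = edgeWord s (l ++ [f]) by rw [edgeWord_append]; simp,
      h.ghostWord_mul_edgeWord hlf] at h1
    rw [← hf, h1, map_zero]
  · intro m hm hml
    rw [smul_mul_assoc, smul_mul_assoc, mul_smul_comm, mul_assoc (edgeWord s m), ← hf,
      h.source_mul, show edgeWord s m * s f = edgeWord s (m ++ [f]) by rw [edgeWord_append]; simp,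
      ← mul_assoc, h.ghostWord_mul_edgeWord_eq_zero, zero_mul, smul_zero]
    · intro hpre
      rw [List.prefix_concat_iff] at hpre
      rcases hpre with hpre | hpre
      · exact hml (by simpa using hpre.symm)
      · exact hfl m hm (hpre.subset (by simp))
    · intro hpre
      rw [List.prefix_concat_iff] at hpre
      rcases hpre with hpre | hpre
      · exact hml (by simpa using hpre)
      · exact hfl l hl (hpre.subset (by simp))
  · exact fun hh => absurd hl hh

end Uniqueness


/-! ### Induction on the length of ghost paths -/

section Uniqueness

variable {V : Type*} {E : Type*} {G : Ultragraph V E} {R : Type*} [CommRing R]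
variable {U : Type*} [Ring U] [Algebra R U] {W : Type*} [Ring W] [Algebra R W]
variable {p : G.GenVertex → U} {s t : E → U} (h : G.IsLeavittFamily p s t)
variable {Φ : U →ₐ[R] W} (hΦ : G.IsReductionFaithful R p s Φ)

include h

theorem IsLeavittFamily.mul_edge_mem_wordSpan {n : ℕ} {x : U}
    (hx : x ∈ wordSpan G R p s t (n + 1)) (f : E) : x * s f ∈ wordSpan G R p s t n := by
  induction hx using Submodule.span_induction with
  | mem x hx =>
    obtain ⟨l, A, l', hl', rfl⟩ := hx
    cases l' with
    | nil =>
      rw [ghostWord_nil, mul_one, mul_assoc]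
      by_cases hf : G.source f ∈ A.1
      · rw [h.p_mul_edge hf, ← h.mul_range, ← mul_assoc,
          show edgeWord s l * s f = edgeWord s (l ++ [f]) by rw [edgeWord_append]; simp]
        exact wordSpan_mono n.zero_le (mem_wordSpan_zero _ _)
      · rw [h.p_mul_edge_of_notMem hf, mul_zero]
        exact Submodule.zero_mem _
    | cons e l' =>
      rw [ghostWord_cons, mul_assoc, mul_assoc (ghostWord t l')]
      by_cases hef : e = f
      · subst hef
        rw [h.ghost_mul_self]
        by_cases hl : l' = []
        · subst hl
          rw [ghostWord_nil, one_mul, mul_assoc, h.p_mul]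
          exact wordSpan_mono n.zero_le (mem_wordSpan_zero _ _)
        · rcases h.ghostWord_mul_p (G.rng e) hl with h0 | h0
          · rw [h0]
            exact mem_wordSpan l A l' (by simpa using hl')
          · rw [h0, mul_zero]
            exact Submodule.zero_mem _
      · rw [h.ghost_mul_of_ne e f hef, mul_zero, mul_zero]
        exact Submodule.zero_mem _
  | zero => rw [zero_mul]; exact Submodule.zero_mem _
  | add x y _ _ hx hy => rw [add_mul]; exact Submodule.add_mem _ hx hy
  | smul c x _ hx => rw [smul_mul_assoc]; exact Submodule.smul_mem _ _ hx

theorem IsLeavittFamily.mul_p_mem_wordSpan_zero {x : U} (hx : x ∈ wordSpan G R p s t 0)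
    (A : G.GenVertex) : x * p A ∈ wordSpan G R p s t 0 := by
  induction hx using Submodule.span_induction with
  | mem x hx =>
    obtain ⟨l, C, l', hl', rfl⟩ := hx
    rw [List.length_eq_zero_iff.1 (Nat.le_zero.1 hl'), ghostWord_nil, mul_one, mul_assoc, h.p_mul]
    exact mem_wordSpan_zero _ _
  | zero => rw [zero_mul]; exact Submodule.zero_mem _
  | add x y _ _ hx hy => rw [add_mul]; exact Submodule.add_mem _ hx hy
  | smul c x _ hx => rw [smul_mul_assoc]; exact Submodule.smul_mem _ _ hx

theorem IsLeavittFamily.ghost_mul_sum {e : E} {S : Finset E} (he : e ∈ S) :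
    t e * ∑ f ∈ S, s f * t f = t e := by
  rw [Finset.mul_sum, Finset.sum_eq_single e]
  · rw [← mul_assoc, h.ghost_mul_self, h.range_mul_ghost]
  · intro f _ hf
    rw [← mul_assoc, h.ghost_mul_of_ne e f hf.symm, zero_mul]
  · exact fun hh => absurd he hh

/-- Here `y` collects the terms without ghost edges. A word ending in the ghost of `e` is fixed by
`∑ s_f s_f^*` once `e` is among the `f`; allowing every larger `S'` makes the property stable under
sums. -/
theorem IsLeavittFamily.exists_sub_mul_eq {n : ℕ} {x : U} (hx : x ∈ wordSpan G R p s t n) :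
    ∃ y ∈ wordSpan G R p s t 0, ∃ S : Finset E, ∀ S', S ⊆ S' →
      (x - y) * ∑ f ∈ S', s f * t f = x - y := by
  classical
  induction hx using Submodule.span_induction with
  | mem x hx =>
    obtain ⟨l, A, l', hl', rfl⟩ := hx
    cases l' with
    | nil =>
      refine ⟨edgeWord s l * p A, mem_wordSpan_zero _ _, ∅, fun S' _ => ?_⟩
      rw [ghostWord_nil, mul_one, sub_self, zero_mul]
    | cons e l' =>
      refine ⟨0, Submodule.zero_mem _, {e}, fun S' hS' => ?_⟩
      rw [sub_zero, ghostWord_cons, mul_assoc, mul_assoc (ghostWord t l'),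
        h.ghost_mul_sum (hS' (Finset.mem_singleton_self e))]
  | zero => exact ⟨0, Submodule.zero_mem _, ∅, by simp⟩
  | add x x' _ _ hx hx' =>
    obtain ⟨y, hy, S, hS⟩ := hx
    obtain ⟨y', hy', S', hS'⟩ := hx'
    refine ⟨y + y', Submodule.add_mem _ hy hy', S ∪ S', fun S'' hS'' => ?_⟩
    rw [add_sub_add_comm, add_mul, hS S'' (Finset.subset_union_left.trans hS''),
      hS' S'' (Finset.subset_union_right.trans hS'')]
  | smul c x _ hx =>
    obtain ⟨y, hy, S, hS⟩ := hx
    refine ⟨c • y, Submodule.smul_mem _ _ hy, S, fun S' hS' => ?_⟩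
    rw [← smul_sub, smul_mul_assoc, hS S' hS']

theorem IsLeavittFamily.vtx_mul_edge_mul_ghost (v : V) (e : E) :
    p (G.vtx v) * (s e * t e) = s e * t e * p (G.vtx v) := by
  by_cases hv : G.source e ∈ (G.vtx v).1
  · rw [← mul_assoc, h.p_mul_edge hv, mul_assoc, h.ghost_mul_p hv]
  · rw [← mul_assoc, h.p_mul_edge_of_notMem hv, mul_assoc, h.ghost_mul_p_of_notMem hv, zero_mul,
      mul_zero]

include hΦ

/-- A homomorphism from a Leavitt path algebra is injective if it kills neither nonzero multiples
of vertices nor polynomials with nonzero constant term in cycles without exits. -/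
theorem IsReductionFaithful.eq_zero_of_mem_wordSpan (n : ℕ) {x : U}
    (hx : x ∈ wordSpan G R p s t n) (hx0 : Φ x = 0) : x = 0 := by
  classical
  induction n generalizing x with
  | zero => exact hΦ.eq_zero_of_mem_wordSpan_zero h hx hx0
  | succ n ih =>
    have hxs : ∀ f, x * s f = 0 := fun f =>
      ih (h.mul_edge_mem_wordSpan hx f) (by rw [map_mul, hx0, zero_mul])
    obtain ⟨y, hy, S, hS⟩ := h.exists_sub_mul_eq hx
    have hq := hS S subset_rfl
    rw [sub_mul, show x * ∑ f ∈ S, s f * t f = 0 by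
      rw [Finset.mul_sum]
      exact Finset.sum_eq_zero fun f _ => by rw [← mul_assoc, hxs, zero_mul], zero_sub] at hq
    -- With `q = ∑ s_f s_f^*`, the relation `x q = 0` and `(x - y) q = x - y` combine to `x = y - y
    -- q`.
    have hxy : x = y - y * ∑ f ∈ S, s f * t f := by
      rw [sub_eq_add_neg, hq]; abel
    have hxv : ∀ v, x * p (G.vtx v) = 0 := by
      intro v
      by_cases hfin : {e | G.source e = v}.Finite
      · by_cases hne : {e | G.source e = v}.Nonempty
        · rw [h.vertex v hfin hne, Finset.mul_sum]
          exact Finset.sum_eq_zero fun f _ => by rw [← mul_assoc, hxs, zero_mul]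
        -- At a sink `q p_v = 0`, so `x p_v` has no ghost edges.
        · have hxvy : x * p (G.vtx v) = y * p (G.vtx v) := by
            rw [hxy, sub_mul, mul_assoc, Finset.sum_mul, Finset.sum_eq_zero, mul_zero, sub_zero]
            intro f _
            rw [mul_assoc, h.ghost_mul_p_of_notMem, mul_zero]
            exact fun hf => hne ⟨f, hf⟩
          refine ih (wordSpan_mono n.zero_le ?_) (by rw [map_mul, hx0, zero_mul])
          rw [hxvy]
          exact h.mul_p_mem_wordSpan_zero hy _
      -- At an infinite emitter, `x s_e = 0` reads `y s_e = 0` for `e ∉ S`. Since `q` commutes with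
      -- `p_v`, `y p_v = 0` then gives `x p_v = 0`.
      · have hyv : y * p (G.vtx v) = 0 := by
          refine hΦ.mul_vtx_eq_zero h hfin hy S fun e he _ => ?_
          have := hxs e
          rw [hxy, sub_mul, mul_assoc, Finset.sum_mul, Finset.sum_eq_zero, mul_zero, sub_zero]
            at this
          · exact this
          · intro f hf
            rw [mul_assoc, h.ghost_mul_of_ne f e (by rintro rfl; exact he hf), mul_zero]
        rw [hxy, sub_mul, hyv, mul_assoc, Finset.sum_mul,
          ← Finset.sum_congr rfl fun e _ => h.vtx_mul_edge_mul_ghost v e, ← Finset.mul_sum,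
          ← mul_assoc, hyv, zero_mul, sub_zero]
    -- Let `F` be the sum of the `p_v` over the sources of `S`. From `q F = q` and `x F = 0` follows
    -- `y q = y F`, so `x = y - y F` has no ghost edges.
    have hqF : (∑ f ∈ S, s f * t f) * ∑ v ∈ S.image G.source, p (G.vtx v) =
        ∑ f ∈ S, s f * t f := by
      rw [Finset.sum_mul]
      refine Finset.sum_congr rfl fun f hf => ?_
      rw [mul_assoc, Finset.mul_sum, Finset.sum_eq_single (G.source f), h.ghost_mul_source]
      · exact fun v _ hv => h.ghost_mul_p_of_notMem fun hh => hv (Set.mem_singleton_iff.1 hh).symm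
      · exact fun hh => absurd (Finset.mem_image_of_mem _ hf) hh
    have hxF : x * ∑ v ∈ S.image G.source, p (G.vtx v) = 0 := by
      rw [Finset.mul_sum]
      exact Finset.sum_eq_zero fun v _ => hxv v
    rw [hxy, sub_mul, mul_assoc, hqF, sub_eq_zero] at hxF
    refine ih (wordSpan_mono n.zero_le ?_) hx0
    rw [hxy, ← hxF, Finset.mul_sum]
    exact Submodule.sub_mem _ hy
      (Submodule.sum_mem _ fun v _ => h.mul_p_mem_wordSpan_zero hy _)

end Uniqueness


/-! ### The unitization and its spanning words -/

section Unital

variable {V : Type*} {E : Type*} {G : Ultragraph V E}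

theorem IsLeavittFamily.map {A B F : Type*} [NonUnitalRing A] [NonUnitalRing B] [FunLike F A B]
    [NonUnitalRingHomClass F A B] (φ : F) {p : G.GenVertex → A} {s t : E → A}
    (h : G.IsLeavittFamily p s t) :
    G.IsLeavittFamily (fun A => φ (p A)) (fun e => φ (s e)) (fun e => φ (t e)) where
  p_empty := by rw [h.p_empty, map_zero]
  p_mul A C := by rw [← map_mul, h.p_mul]
  p_union A C := by rw [h.p_union, map_sub, map_add]
  source_mul e := by rw [← map_mul, h.source_mul]
  mul_range e := by rw [← map_mul, h.mul_range]
  range_mul_ghost e := by rw [← map_mul, h.range_mul_ghost]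
  ghost_mul_source e := by rw [← map_mul, h.ghost_mul_source]
  ghost_mul_self e := by rw [← map_mul, h.ghost_mul_self]
  ghost_mul_of_ne e f hef := by rw [← map_mul, h.ghost_mul_of_ne e f hef, map_zero]
  vertex v hf hne := by rw [h.vertex v hf hne, map_sum]; simp_rw [map_mul]

variable (G) (R : Type*) [CommRing R]

namespace LeavittPathAlgebra

/-- The Leavitt path algebra with a unit adjoined. -/
abbrev Unital : Type _ := Unitization R (G.LeavittPathAlgebra R)

/-- The inclusion of the Leavitt path algebra into its unitization. -/
noncomputable abbrev incl : G.LeavittPathAlgebra R →ₙₐ[R] Unital G R :=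
  Unitization.inrNonUnitalAlgHom R (G.LeavittPathAlgebra R)

theorem isLeavittFamily_incl : G.IsLeavittFamily (fun A => incl G R (p G R A))
    (fun e => incl G R (s G R e)) (fun e => incl G R (sStar G R e)) :=
  (isLeavittFamily G R).map (incl G R)

variable {G R}

section Span

variable {U : Type*} [Ring U] [Algebra R U]
variable {p : G.GenVertex → U} {s t : E → U}

theorem _root_.Ultragraph.IsLeavittFamily.mul_mem_span
    (h : G.IsLeavittFamily p s t) (g : G.LeavittGen) {x : U}
    (hx : ∃ n, x ∈ wordSpan G R p s t n) :
    ∃ n, genVal p s t g * x ∈ wordSpan G R p s t n := by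
  have key : ∀ (l : List E) (A : G.GenVertex) (l' : List E) (C : G.GenVertex),
      p C * (edgeWord s l * p A * ghostWord t l') ∈ wordSpan G R p s t l'.length := by
    intro l A l' C
    cases l with
    | nil =>
      rw [edgeWord_nil, one_mul, ← mul_assoc, h.p_mul]
      simpa using mem_wordSpan (R := R) (s := s) [] (C ∩ A) l' le_rfl
    | cons e l =>
      rw [← mul_assoc, ← mul_assoc]
      rcases h.p_mul_edgeWord C (l := e :: l) (by simp) with h0 | h0
      · rw [h0]; exact mem_wordSpan _ _ _ le_rfl
      · rw [h0, zero_mul, zero_mul]; exact Submodule.zero_mem _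
  obtain ⟨n, hx⟩ := hx
  -- A ghost edge multiplied onto a word with empty edge part lengthens the ghost path by one.
  refine ⟨n + 1, ?_⟩
  induction hx using Submodule.span_induction with
  | mem x hx =>
    obtain ⟨l, A, l', hl', rfl⟩ := hx
    cases g with
    | vert C => exact wordSpan_mono (hl'.trans n.le_succ) (key l A l' C)
    | edge e =>
      rw [← mul_assoc, ← mul_assoc]
      change s e * edgeWord s l * p A * ghostWord t l' ∈ _
      rw [← edgeWord_cons]
      exact mem_wordSpan _ _ _ (hl'.trans n.le_succ)
    | ghost e =>
      change t e * _ ∈ _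
      cases l with
      | nil =>
        rw [edgeWord_nil, one_mul, ← mul_assoc]
        by_cases he : G.source e ∈ A.1
        · rw [h.ghost_mul_p he, ← h.range_mul_ghost, mul_assoc,
            show t e * ghostWord t l' = ghostWord t (l' ++ [e]) by rw [ghostWord_append]; simp]
          simpa using mem_wordSpan (R := R) (s := s) [] (G.rng e) (l' ++ [e]) (n := n + 1)
            (by simpa using hl')
        · rw [h.ghost_mul_p_of_notMem he, zero_mul]
          exact Submodule.zero_mem _
      | cons f l =>
        rw [edgeWord_cons, ← mul_assoc, ← mul_assoc, ← mul_assoc]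
        by_cases hef : e = f
        · subst hef
          rw [h.ghost_mul_self, mul_assoc, mul_assoc, ← mul_assoc (edgeWord s l)]
          exact wordSpan_mono (hl'.trans n.le_succ) (key l A l' (G.rng e))
        · rw [h.ghost_mul_of_ne e f hef, zero_mul, zero_mul, zero_mul]
          exact Submodule.zero_mem _
  | zero => rw [mul_zero]; exact Submodule.zero_mem _
  | add x y _ _ hx hy => rw [mul_add]; exact Submodule.add_mem _ hx hy
  | smul c x _ hx => rw [mul_smul_comm]; exact Submodule.smul_mem _ _ hx

theorem _root_.Ultragraph.IsLeavittFamily.genVal_mem_span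
    (h : G.IsLeavittFamily p s t) (g : G.LeavittGen) :
    ∃ n, genVal p s t g ∈ wordSpan G R p s t n := by
  cases g with
  | vert A => exact ⟨0, by
      simpa [genVal] using mem_wordSpan_zero (R := R) (s := s) (t := t) [] A⟩
  | edge e => exact ⟨0, by
      simpa [h.mul_range, genVal] using mem_wordSpan_zero (R := R) (p := p) (s := s) (t := t) [e] (G.rng e)⟩
  | ghost e => exact ⟨1, by
      simpa [h.range_mul_ghost, genVal] using
        mem_wordSpan (R := R) (p := p) (s := s) (t := t) [] (G.rng e) [e] (n := 1) (by simp)⟩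

theorem _root_.Ultragraph.IsLeavittFamily.freeLift_mem_span
    (h : G.IsLeavittFamily p s t) (x : G.FreeGen R) :
    ∃ n, freeLift R p s t x ∈ wordSpan G R p s t n := by
  have hword : ∀ w : FreeSemigroup G.LeavittGen,
      ∃ n, FreeSemigroup.lift (genVal p s t) w ∈ wordSpan G R p s t n := by
    intro w
    induction w using FreeSemigroup.recOnMul with
    | ih1 g => simpa using h.genVal_mem_span g
    | ih2 g w _ ih =>
      rw [map_mul, FreeSemigroup.lift_of]
      exact h.mul_mem_span g ih
  induction x using MonoidAlgebra.induction_linear with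
  | zero => exact ⟨0, by rw [map_zero]; exact Submodule.zero_mem _⟩
  | add x y hx hy =>
    obtain ⟨m, hm⟩ := hx
    obtain ⟨n, hn⟩ := hy
    refine ⟨max m n, ?_⟩
    rw [map_add]
    exact Submodule.add_mem _ (wordSpan_mono (le_max_left m n) hm)
      (wordSpan_mono (le_max_right m n) hn)
  | single w r =>
    obtain ⟨n, hn⟩ := hword w
    refine ⟨n, ?_⟩
    have : freeLift R p s t (MonoidAlgebra.single w r) =
        r • FreeSemigroup.lift (genVal p s t) w := by
      simp [freeLift, MonoidAlgebra.liftMagma]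
    rw [this]
    exact Submodule.smul_mem _ _ hn

end Span

/-- By uniqueness of homomorphisms on generators, `incl` is the `lift` of the included family, so
its values are those of `freeLift`. -/
theorem incl_mem_wordSpan (x : G.LeavittPathAlgebra R) :
    ∃ n, incl G R x ∈ wordSpan G R (fun A => incl G R (p G R A))
      (fun e => incl G R (s G R e)) (fun e => incl G R (sStar G R e)) n := by
  obtain ⟨x, rfl⟩ := mk_surjective G R x
  obtain ⟨n, hn⟩ := (isLeavittFamily_incl G R).freeLift_mem_span (R := R) x
  refine ⟨n, ?_⟩
  have hincl : incl G R = lift R (isLeavittFamily_incl G R) := by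
    refine hom_ext R (fun A => ?_) (fun e => ?_) (fun e => ?_)
    · rw [lift_p]
    · rw [lift_s]
    · rw [lift_sStar]
  have hx := DFunLike.congr_fun hincl (mk G R x)
  rw [hx]
  exact hn

end LeavittPathAlgebra

end Unital


/-! ### Action of paths on functions, and sufficiency -/

namespace BranchingSystem

open LeavittPathAlgebra

variable {V : Type*} {E : Type*} {G : Ultragraph V E} {X : Type*}
variable (R : Type*) [CommRing R] (B : G.BranchingSystem X)

/-- The unital extension of the induced representation. -/
noncomputable def unitalRep : Unital G R →ₐ[R] Module.End R (X → R) :=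
  Unitization.lift (B.inducedRep R)

theorem unitalRep_incl (x : G.LeavittPathAlgebra R) :
    B.unitalRep R (incl G R x) = B.inducedRep R x := by
  simp [unitalRep]

theorem unitalRep_p (A : G.GenVertex) : B.unitalRep R (incl G R (p G R A)) = B.P R A := by
  rw [unitalRep_incl]; exact lift_p R _ A

theorem unitalRep_s (e : E) : B.unitalRep R (incl G R (s G R e)) = B.S R e := by
  rw [unitalRep_incl]; exact lift_s R _ e

theorem unitalRep_edgeWord (l : List E) :
    B.unitalRep R (edgeWord (fun e => incl G R (s G R e)) l) = (l.map (B.S R)).prod := by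
  induction l with
  | nil => simp
  | cons e l ih => rw [edgeWord_cons, map_mul, ih, unitalRep_s, List.map_cons, List.prod_cons]

theorem pathMap_succ {k : ℕ} (c : Fin (k + 1 + 1) → E) (z : X) :
    B.pathMap c z = B.edgeMap (c 0) (B.pathMap (fun i : Fin (k + 1) => c i.succ) z) := by
  simp [pathMap]

theorem pathMap_zero (c : Fin 1 → E) (z : X) : B.pathMap c z = B.edgeMap (c 0) z := by
  simp [pathMap]

theorem S_apply_edgeMap {e : E} {z : X} (hz : z ∈ B.D (G.rng e)) (φ : X → R) :
    B.S R e φ (B.edgeMap e z) = φ z := by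
  simp [S, edgeMap, hz]

theorem S_apply_of_notMem {e : E} {z : X} (hz : z ∉ B.R e) (φ : X → R) :
    B.S R e φ z = 0 := by
  simp [S, hz]

theorem S_single [DecidableEq X] {e : E} {z : X} (hz : z ∈ B.D (G.rng e)) :
    B.S R e (Pi.single z 1) = Pi.single (B.edgeMap e z) 1 := by
  funext y
  by_cases hy : y ∈ B.R e
  · obtain ⟨⟨x, hx⟩, hxy⟩ := (B.f e).surjective ⟨y, hy⟩
    have : y = B.edgeMap e x := by simp [edgeMap, hx, hxy]
    rw [this, S_apply_edgeMap R B hx]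
    have hiff : B.edgeMap e x = B.edgeMap e z ↔ x = z := by
      simp [edgeMap, hx, hz, Subtype.coe_inj]
    simp [Pi.single_apply, hiff]
  · rw [S_apply_of_notMem R B hy, Pi.single_apply, if_neg]
    rintro rfl
    exact hy (B.edgeMap_mem e hz)

theorem prod_S_apply_pathMap : ∀ {k : ℕ} (c : Fin (k + 1) → E), G.IsPath c → ∀ {z : X},
    z ∈ B.D (G.rng (c (Fin.last k))) → ∀ φ : X → R,
      ((List.ofFn c).map (B.S R)).prod φ (B.pathMap c z) = φ z
  | 0, c, _, z, hz, φ => by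
    simpa [pathMap_zero] using B.S_apply_edgeMap R (e := c 0) hz φ
  | k + 1, c, hc, z, hz, φ => by
    have hm := B.pathMap_mem (fun i : Fin (k + 1) => c i.succ) (fun i => hc i.succ) (z := z) hz
    have ih := prod_S_apply_pathMap (fun i : Fin (k + 1) => c i.succ) (fun i => hc i.succ)
      (z := z) hz φ
    rw [List.ofFn_succ (f := c), List.map_cons, List.prod_cons, pathMap_succ, Module.End.mul_apply,
      S_apply_edgeMap R B (e := c 0) (B.R_subset_of_mem (hc 0) hm), ih]

theorem prod_S_single [DecidableEq X] : ∀ {k : ℕ} (c : Fin (k + 1) → E), G.IsPath c → ∀ {z : X},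
    z ∈ B.D (G.rng (c (Fin.last k))) →
      ((List.ofFn c).map (B.S R)).prod (Pi.single z 1) = Pi.single (B.pathMap c z) 1
  | 0, c, _, z, hz => by
    simpa [pathMap_zero] using B.S_single R (e := c 0) hz
  | k + 1, c, hc, z, hz => by
    have hm := B.pathMap_mem (fun i : Fin (k + 1) => c i.succ) (fun i => hc i.succ) (z := z) hz
    have ih := prod_S_single (fun i : Fin (k + 1) => c i.succ) (fun i => hc i.succ) (z := z) hz
    rw [List.ofFn_succ (f := c), List.map_cons, List.prod_cons, pathMap_succ, Module.End.mul_apply,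
      ih, S_single R B (e := c 0) (B.R_subset_of_mem (hc 0) hm)]

theorem prod_S_pow_single [DecidableEq X] {k : ℕ} {c : Fin (k + 1) → E} (hc : G.IsClosedPath c) {z : X}
    (hz : z ∈ B.D (G.rng (c (Fin.last k)))) (m : ℕ) :
    (((List.ofFn c).map (B.S R)).prod ^ m) (Pi.single z 1) =
      Pi.single ((B.pathMap c)^[m] z) 1 := by
  induction m with
  | zero => simp
  | succ m ih =>
    rw [pow_succ', Module.End.mul_apply, ih,
      B.prod_S_single R c hc.1 ((B.pathMap_mapsTo c hc).iterate m hz), Function.iterate_succ_apply']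

theorem prod_S_pow_apply {k : ℕ} {c : Fin (k + 1) → E} (hc : G.IsClosedPath c) {z : X}
    (hz : z ∈ B.D (G.rng (c (Fin.last k)))) (m : ℕ) (φ : X → R) :
    (((List.ofFn c).map (B.S R)).prod ^ m) φ ((B.pathMap c)^[m] z) = φ z := by
  induction m with
  | zero => simp
  | succ m ih =>
    rw [pow_succ', Module.End.mul_apply, Function.iterate_succ_apply',
      B.prod_S_apply_pathMap R c hc.1 ((B.pathMap_mapsTo c hc).iterate m hz), ih]

theorem prod_S_apply_of_notMem {k : ℕ} {c : Fin (k + 1) → E} (hc : G.IsClosedPath c) {z : X}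
    (hz : z ∉ B.D (G.rng (c (Fin.last k)))) (φ : X → R) :
    ((List.ofFn c).map (B.S R)).prod φ z = 0 := by
  rw [List.ofFn_succ (f := c), List.map_cons, List.prod_cons, Module.End.mul_apply,
    S_apply_of_notMem]
  exact fun h => hz (B.R_subset_of_mem hc.2 h)

theorem P_single {A : G.GenVertex} {z : X} (hz : z ∈ B.D A) [DecidableEq X] :
    B.P R A (Pi.single z 1) = Pi.single z 1 := by
  funext y
  by_cases hy : y = z
  · subst hy; simp [P, hz]
  · simp [P, hy]

/-- The induced representation is faithful on vertices and on polynomials in cycles without exit,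
provided that the cycles without exit have points with large period. -/
theorem isReductionFaithful [Nontrivial R] (hD : ∀ A : G.GenVertex, A ≠ ∅ → (B.D A).Nonempty)
    (hB : ∀ (k : ℕ) (c : Fin (k + 1) → E), G.IsCycle c → ¬ G.HasExit c →
      ∀ F : Finset ℕ, (∀ n ∈ F, 0 < n) →
        ∃ z₀ ∈ B.D (G.rng (c (Fin.last k))), ∀ n ∈ F, (B.pathMap c)^[n] z₀ ≠ z₀) :
    G.IsReductionFaithful R (fun A => incl G R (p G R A)) (fun e => incl G R (s G R e))
      (B.unitalRep R) where
  vtx v r hr := by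
    have hne : G.vtx v ≠ ∅ := fun h => Set.singleton_ne_empty v (congrArg Subtype.val h)
    obtain ⟨z, hz⟩ := hD _ hne
    have := congrFun (LinearMap.congr_fun hr fun _ => (1 : R)) z
    rw [map_smul, unitalRep_p] at this
    simpa [P, hz] using this
  cycle k c hc he r y hy hr := by
    classical
    -- The power `c^(m+1)` sends the indicator of `z` to that of `f_c^(m+1)(z)`, so `F` collects the
    -- exponents occurring in `y`.
    have key : ∃ F : Finset ℕ, (∀ n ∈ F, 0 < n) ∧ ∀ z ∈ B.D (G.rng (c (Fin.last k))),
        (∀ n ∈ F, (B.pathMap c)^[n] z ≠ z) → B.unitalRep R y (Pi.single z 1) z = 0 := by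
      clear hr
      induction hy using Submodule.span_induction with
      | mem x hx =>
        obtain ⟨m, rfl⟩ := hx
        refine ⟨{m + 1}, by simp, fun z hz hF => ?_⟩
        beta_reduce
        rw [map_mul, map_pow, unitalRep_edgeWord, unitalRep_p, Module.End.mul_apply,
          P_single R B hz, prod_S_pow_single R B hc.1 hz, Pi.single_apply, if_neg]
        exact (hF _ (Finset.mem_singleton_self _)).symm
      | zero => exact ⟨∅, by simp, fun z _ _ => by rw [map_zero]; rfl⟩
      | add x y _ _ hx hy =>
        obtain ⟨F, hF, hx⟩ := hx
        obtain ⟨F', hF', hy⟩ := hy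
        refine ⟨F ∪ F', fun n hn => (Finset.mem_union.1 hn).elim (hF n) (hF' n),
          fun z hz hn => ?_⟩
        rw [map_add, LinearMap.add_apply, Pi.add_apply,
          hx z hz fun n hn' => hn n (Finset.mem_union_left _ hn'),
          hy z hz fun n hn' => hn n (Finset.mem_union_right _ hn'), add_zero]
      | smul a x _ hx =>
        obtain ⟨F, hF, hx⟩ := hx
        refine ⟨F, hF, fun z hz hn => ?_⟩
        rw [map_smul, LinearMap.smul_apply, Pi.smul_apply, hx z hz hn, smul_zero]
    obtain ⟨F, hF, hy0⟩ := key
    obtain ⟨z, hz, hzF⟩ := hB k c hc he F hF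
    have := congrFun (LinearMap.congr_fun hr (Pi.single z 1)) z
    rw [map_add, LinearMap.add_apply, Pi.add_apply, hy0 z hz hzF, map_smul, unitalRep_p,
      LinearMap.smul_apply, P_single R B hz] at this
    simpa using this

/-! ### The graded branching system and necessity -/

/-- The branching system on `X × ℤ` in which every edge raises the second coordinate by one. -/
noncomputable def graded : G.BranchingSystem (X × ℤ) where
  R e := Prod.fst ⁻¹' B.R e
  D A := Prod.fst ⁻¹' B.D A
  f e :=
    { toFun := fun z => ⟨(B.f e ⟨z.1.1, z.2⟩, z.1.2 + 1), (B.f e ⟨z.1.1, z.2⟩).2⟩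
      invFun := fun z => ⟨((B.f e).symm ⟨z.1.1, z.2⟩, z.1.2 - 1), ((B.f e).symm ⟨z.1.1, z.2⟩).2⟩
      left_inv := fun z => by simp
      right_inv := fun z => by simp }
  R_disjoint e e' h := by rw [← Set.preimage_inter, B.R_disjoint e e' h, Set.preimage_empty]
  D_empty := by rw [B.D_empty, Set.preimage_empty]
  D_inter A C := by rw [← Set.preimage_inter, B.D_inter]
  D_union A C := by rw [← Set.preimage_union, B.D_union]
  R_subset e := Set.preimage_mono (B.R_subset e)
  D_vertex v hf hne := by rw [B.D_vertex v hf hne]; simp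

theorem graded_edgeMap_snd {e : E} {z : X × ℤ} (hz : z ∈ B.graded.D (G.rng e)) :
    (B.graded.edgeMap e z).2 = z.2 + 1 := by
  simp only [edgeMap, hz, dite_true]
  rfl

theorem graded_pathMap_snd : ∀ {k : ℕ} (c : Fin (k + 1) → E), G.IsPath c → ∀ {z : X × ℤ},
    z ∈ B.graded.D (G.rng (c (Fin.last k))) → (B.graded.pathMap c z).2 = z.2 + (k + 1)
  | 0, c, _, z, hz => by
    rw [pathMap_zero, graded_edgeMap_snd B (e := c 0) hz]
    simp
  | k + 1, c, hc, z, hz => by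
    have hm := B.graded.pathMap_mem (fun i : Fin (k + 1) => c i.succ) (fun i => hc i.succ)
      (z := z) hz
    rw [pathMap_succ, graded_edgeMap_snd B (e := c 0) (B.graded.R_subset_of_mem (hc 0) hm),
      graded_pathMap_snd _ (fun i => hc i.succ) hz]
    push_cast
    ring

theorem graded_iterate_pathMap_snd {k : ℕ} {c : Fin (k + 1) → E} (hc : G.IsClosedPath c)
    {z : X × ℤ} (hz : z ∈ B.graded.D (G.rng (c (Fin.last k)))) (m : ℕ) :
    ((B.graded.pathMap c)^[m] z).2 = z.2 + m * (k + 1) := by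
  induction m with
  | zero => simp
  | succ m ih =>
    rw [Function.iterate_succ_apply', graded_pathMap_snd B c hc.1
      ((B.graded.pathMap_mapsTo c hc).iterate m hz), ih]
    push_cast
    ring

/-- If the representation is faithful, then no power of a closed path acts as the identity. -/
theorem exists_iterate_ne [Nontrivial R] (hinj : Function.Injective (B.inducedRep R)) {k : ℕ}
    {c : Fin (k + 1) → E} (hc : G.IsClosedPath c)
    (hne : (B.D (G.rng (c (Fin.last k)))).Nonempty) {N : ℕ} (hN : 0 < N) :
    ∃ z ∈ B.D (G.rng (c (Fin.last k))), (B.pathMap c)^[N] z ≠ z := by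
  classical
  by_contra! hid
  let A := G.rng (c (Fin.last k))
  let T : Unital G R := edgeWord (fun e => incl G R (s G R e)) (List.ofFn c)
  let u : Unital G R := T ^ N * incl G R (p G R A)
  -- Both terms lie in the ideal `L_R(G)` of the unitization, so the scalar part is zero.
  obtain ⟨x, hx⟩ : ∃ x, incl G R x = u - incl G R (p G R A) := by
    refine ⟨(u - incl G R (p G R A)).snd, ?_⟩
    apply Unitization.ext
    · have hfst : ∀ a, Unitization.fstHom R (G.LeavittPathAlgebra R) (incl G R a) = 0 :=
        fun _ => rfl
      change 0 = Unitization.fstHom R (G.LeavittPathAlgebra R) (u - incl G R (p G R A))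
      rw [map_sub, map_mul, hfst, mul_zero, sub_zero]
    · simp
  have hx0 : x = 0 := by
    apply hinj
    rw [map_zero, ← unitalRep_incl, hx, map_sub, map_mul, map_pow, unitalRep_edgeWord,
      unitalRep_p, sub_eq_zero]
    refine LinearMap.ext fun φ => funext fun z => ?_
    by_cases hz : z ∈ B.D A
    · rw [Module.End.mul_apply]
      nth_rewrite 1 [← hid z hz]
      rw [prod_S_pow_apply R B hc hz]
    · obtain ⟨M, rfl⟩ := Nat.exists_eq_succ_of_ne_zero hN.ne'
      rw [Module.End.mul_apply, pow_succ', Module.End.mul_apply,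
        prod_S_apply_of_notMem R B hc hz]
      simp [P, hz]
  -- The graded representation kills this element too, yet `T ^ N` moves the indicator of `(z, 0)`
  -- to second coordinate `N * (k + 1) ≠ 0`.
  have hu : B.graded.unitalRep R (u - incl G R (p G R A)) = 0 := by
    rw [← hx, hx0, map_zero, map_zero]
  obtain ⟨z, hz⟩ := hne
  have hz' : (z, (0 : ℤ)) ∈ B.graded.D A := hz
  have := congrFun (LinearMap.congr_fun hu (Pi.single (z, 0) 1)) (z, 0)
  rw [map_sub, map_mul, map_pow, unitalRep_edgeWord, unitalRep_p, LinearMap.sub_apply,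
    Module.End.mul_apply, P_single R _ hz', prod_S_pow_single R _ hc hz', Pi.sub_apply,
    Pi.single_eq_same, Pi.single_apply, if_neg] at this
  · simp at this
  · intro heq
    have h2 := graded_iterate_pathMap_snd B hc hz' N
    rw [← heq] at h2
    simp at h2
    omega

end BranchingSystem

end Ultragraph

open Ultragraph LeavittPathAlgebra BranchingSystem in
theorem mainTheorem3 {V : Type*} {E : Type*} {X : Type*} {R : Type*} [CommRing R] [Nontrivial R]
    (G : Ultragraph V E) (B : G.BranchingSystem X)
    (hD : ∀ A : G.GenVertex, A ≠ ∅ → (B.D A).Nonempty) :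
    Function.Injective (B.inducedRep R) ↔
      ∀ (k : ℕ) (c : Fin (k + 1) → E), G.IsCycle c → ¬ G.HasExit c →
        ∀ F : Finset ℕ, (∀ n ∈ F, 0 < n) →
          ∃ z₀ ∈ B.D (G.rng (c (Fin.last k))), ∀ n ∈ F, (B.pathMap c)^[n] z₀ ≠ z₀ := by
  constructor
  · intro hinj k c hc _ F hF
    by_contra! hcon
    have hne : G.rng (c (Fin.last k)) ≠ ∅ := fun h =>
      (G.range_nonempty _).ne_empty (congrArg Subtype.val h)
    -- The product is a common multiple of all `n ∈ F`, so a point fixed by one `f_c^n` is fixed by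
    -- `f_c^N`.
    obtain ⟨z, hz, hzne⟩ := B.exists_iterate_ne R hinj hc.1 (hD _ hne) (N := ∏ n ∈ F, n)
      (Finset.prod_pos hF)
    obtain ⟨n, hn, hnz⟩ := hcon z hz
    obtain ⟨m, hm⟩ := Finset.dvd_prod_of_mem (fun n : ℕ => n) hn
    apply hzne
    rw [hm]
    exact Function.IsPeriodicPt.mul_const (f := B.pathMap c) hnz m
  · intro hB
    rw [injective_iff_map_eq_zero]
    intro x hx
    obtain ⟨n, hn⟩ := incl_mem_wordSpan x
    have h0 := (B.isReductionFaithful R hD hB).eq_zero_of_mem_wordSpan (isLeavittFamily_incl G R) n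
      hn (by rw [unitalRep_incl, hx])
    exact Unitization.inr_injective h0
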